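/- Let $G$ be a second countable, locally compact, Hausdorff groupoid and let $p:\mathcal B\to G$ be a separable, saturated Fell bundle: an upper semicontinuous Banach bundle with fibres $B(x)=p^{-1}(x)$ such that the continuous sections vanishing at infinity, $\Gamma_0(G,\mathcal B)$, form a separable Banach space, with a continuous multiplication and involution for which each fibre $B(u)$ over a unit $u$ is a $C^*$-algebra and each $B(x)$ is a $B(r(x))$–$B(s(x))$-imprimitivity bimodule with inner products $ab^*$ and $a^*b$. Let $A=\Gamma_0(G^{(0)},\mathcal B)$ be the associated $C^*$-algebra over the unit space; for $u\in G^{(0)}$ let $A(u)=B(u)$ and let $I(u)=\{f\in A: f(u)=0\}$ be the kernel of $A\to A(u)$. For $P\in\operatorname{Prim}A$ let $u=\sigma_A(P)$ be the unique unit with $I(u)\subseteq P$, and regard $P$ also as an ideal of $A(u)$. Let $G_P=\{x\in G: r(x)=s(x)=u,\ x\cdot P=P\}$ be the stability group of $P$, where $x\cdot P$ is the image of $P$ under the Rieffel correspondence of the imprimitivity bimodule $B(x)$, i.e. $x\cdot P=\{a\in B(r(x)) : a\,B(x)\subseteq\overline{\operatorname{span}}\,B(x)P\}$. Fix a left Haar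 measure $\mu$ on $G_P$, let $\Delta$ be the modular function of $G_P$ (normalized by $\int f(r)\,d\mu(r)=\Delta(s)\int f(rs)\,d\mu(r)$), and let $C^*(G_P,\mathcal B)$ be the universal $C^*$-completion of the $*$-algebra $\Gamma_c(G_P,\mathcal B)$ of continuous compactly supported sections, with $f*g(s)=\int f(r)g(r^{-1}s)\,d\mu(r)$ and $f^*(s)=f(s^{-1})^*$. Suppose that $P$ is locally closed in $\operatorname{Prim}A$ (that is, $\{P\}$ is a locally closed subset for the hull-kernel topology), and that $L$ is an irreducible representation of $C^*(G_P,\mathcal B)$ on a Hilbert space $\mathcal H$ which is the integrated form of a strongly continuous $*$-homomorphism $\pi:\mathcal B|_{G_P}\to B(\mathcal H)$, that is, $$L(f)\xi=\int_{G_P}\pi(f(s))\xi\,\Delta(s)^{-1/2}\,d\mu(s)\qquad(f\in\Gamma_c(G_P,\mathcal B),\ \xi\in\mathcal H),$$ such that $\ker(\pi|_{A(u)})=P$ as ideals of $A(u)$. Then $\pi|_{A(u)}$ is a homogeneous representation of $A(u)$: it is nondegenerate, and for every nonzero projection $E$ in the commutant of $\pi(A(u))$ the subrepresentation of $\pi|_{A(u)}$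 on $E\mathcal H$ has the same kernel as $\pi|_{A(u)}$. -/

import Mathlib

open MeasureTheory Filter Topology
open scoped ENNReal NNReal

universe u v w

noncomputable section

/-! ### Representations, primitive ideals, homogeneous representations -/

section Representations

variable {R : Type w} [NonUnitalRing R] [Module ℂ R] [StarRing R]
variable {H : Type*} [NormedAddCommGroup H] [InnerProductSpace ℂ H] [CompleteSpace H]

/-- A representation `ρ` of a `*`-algebra on a Hilbert space `H` is irreducible if it is nonzero and
`⊥`, `⊤` are the only closed invariant subspaces. -/
def IsIrreducibleRep (ρ : R →⋆ₙₐ[ℂ] (H →L[ℂ] H)) : Prop :=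
  (∃ a, ρ a ≠ 0) ∧
    ∀ M : Submodule ℂ H, IsClosed (M : Set H) → (∀ a, ∀ ξ ∈ M, ρ a ξ ∈ M) → M = ⊥ ∨ M = ⊤

/-- A representation is nondegenerate if the vectors `ρ a ξ` span a dense subspace. -/
def IsNondegenerateRep (ρ : R →⋆ₙₐ[ℂ] (H →L[ℂ] H)) : Prop :=
  (Submodule.span ℂ {η : H | ∃ a ξ, η = ρ a ξ}).topologicalClosure = ⊤

/-- A (nondegenerate) representation `ρ` is homogeneous if for every nonzero projection `e` in the
commutant of its range, the subrepresentation of `ρ` on `e H` has the same kernel as `ρ`.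
(The inclusion `ker ρ ⊆ ker ρᵉ` is automatic.) -/
def IsHomogeneousRep (ρ : R →⋆ₙₐ[ℂ] (H →L[ℂ] H)) : Prop :=
  IsNondegenerateRep ρ ∧
    ∀ e : H →L[ℂ] H, IsStarProjection e → e ≠ 0 → (∀ a, Commute e (ρ a)) →
      ∀ a, (∀ ξ, ρ a (e ξ) = 0) → ρ a = 0

variable (R) in
/-- The primitive ideal space of a (`C*`-)algebra `R`: the kernels of its irreducible
representations. -/
def Prim : Type w :=
  {P : TwoSidedIdeal R // ∃ (K : Type w) (_ : NormedAddCommGroup K) (_ : InnerProductSpace ℂ K)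
    (_ : CompleteSpace K) (ρ : R →⋆ₙₐ[ℂ] (K →L[ℂ] K)), IsIrreducibleRep ρ ∧
      P = TwoSidedIdeal.ker ρ}

/-- The hull-kernel (Jacobson) topology: its open sets are the sets `{P | ¬ I ⊆ P}` for ideals `I`,
that is, the unions of sets of the form `{P | a ∉ P}`. -/
instance : TopologicalSpace (Prim R) :=
  TopologicalSpace.generateFrom {U | ∃ a : R, U = {P : Prim R | a ∉ P.1}}

end Representations

/-! ### Topological groupoids -/

/-- A topological groupoid, given by its space of arrows `G`. The product `gmul x y` is meaningful
only if `src x = rng y` (its other values are irrelevant); units are identified with the arrows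
`u` such that `rng u = u`. -/
class TopGroupoid (G : Type u) [TopologicalSpace G] where
  gmul : G → G → G
  ginv : G → G
  rng : G → G
  src : G → G
  rng_rng : ∀ x, rng (rng x) = rng x
  src_rng : ∀ x, src (rng x) = rng x
  rng_src : ∀ x, rng (src x) = src x
  src_src : ∀ x, src (src x) = src x
  rng_gmul : ∀ x y, src x = rng y → rng (gmul x y) = rng x
  src_gmul : ∀ x y, src x = rng y → src (gmul x y) = src y
  gmul_assoc : ∀ x y z, src x = rng y → src y = rng z →
    gmul (gmul x y) z = gmul x (gmul y z)
  rng_gmul_self : ∀ x, gmul (rng x) x = x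
  self_gmul_src : ∀ x, gmul x (src x) = x
  rng_ginv : ∀ x, rng (ginv x) = src x
  src_ginv : ∀ x, src (ginv x) = rng x
  gmul_ginv : ∀ x, gmul x (ginv x) = rng x
  ginv_gmul : ∀ x, gmul (ginv x) x = src x
  continuousOn_gmul : ContinuousOn (fun z : G × G => gmul z.1 z.2) {z | src z.1 = rng z.2}
  continuous_ginv : Continuous ginv

open TopGroupoid

section Groupoid

variable {G : Type u} [TopologicalSpace G] [TopGroupoid G]

variable (G) in
/-- The unit space of a groupoid. -/
abbrev UnitSpace : Type u := {x : G // rng x = x}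

theorem src_unit (u : UnitSpace G) : src u.1 = u.1 := by
  rw [← u.2, src_rng]

theorem gmul_unit (u : UnitSpace G) : gmul u.1 u.1 = u.1 := by
  conv_lhs => arg 1; rw [← u.2]
  exact rng_gmul_self _

theorem ginv_unit (u : UnitSpace G) : ginv u.1 = u.1 := by
  have h := rng_gmul_self (ginv u.1)
  rw [rng_ginv, src_unit, gmul_ginv, u.2] at h
  exact h.symm

theorem ginv_ginv (x : G) : ginv (ginv x) = x := by
  have h1 : gmul (gmul (ginv (ginv x)) (ginv x)) x = x := by
    rw [ginv_gmul, src_ginv, rng_gmul_self]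
  rw [gmul_assoc _ _ _ (by rw [src_ginv]) (by rw [src_ginv]), ginv_gmul] at h1
  have h2 := self_gmul_src (ginv (ginv x))
  rw [src_ginv, rng_ginv] at h2
  rw [← h2, h1]

/-- The stability (isotropy) group `G(u) = {x | r(x) = u = s(x)}` of a unit `u`. -/
@[ext]
structure Isotropy (u : UnitSpace G) : Type u where
  val : G
  rng_val : rng val = u.1
  src_val : src val = u.1

namespace Isotropy

variable {u : UnitSpace G}

instance : TopologicalSpace (Isotropy u) := TopologicalSpace.induced Isotropy.val inferInstance

instance : MeasurableSpace (Isotropy u) := borel _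

instance : BorelSpace (Isotropy u) := ⟨rfl⟩

instance : Group (Isotropy u) where
  mul x y := ⟨gmul x.val y.val,
    by rw [rng_gmul _ _ (x.src_val.trans y.rng_val.symm), x.rng_val],
    by rw [src_gmul _ _ (x.src_val.trans y.rng_val.symm), y.src_val]⟩
  one := ⟨u.1, u.2, src_unit u⟩
  inv x := ⟨ginv x.val, by rw [rng_ginv, x.src_val], by rw [src_ginv, x.rng_val]⟩
  mul_assoc x y z := Isotropy.ext
    (gmul_assoc _ _ _ (x.src_val.trans y.rng_val.symm) (y.src_val.trans z.rng_val.symm))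
  one_mul x := Isotropy.ext ((congrArg (fun t => gmul t x.val) x.rng_val.symm).trans (rng_gmul_self x.val))
  mul_one x := Isotropy.ext ((congrArg (fun t => gmul x.val t) x.src_val.symm).trans (self_gmul_src x.val))
  inv_mul_cancel x := Isotropy.ext ((ginv_gmul x.val).trans x.src_val)

theorem continuous_val : Continuous (Isotropy.val : Isotropy u → G) := continuous_induced_dom

instance : IsTopologicalGroup (Isotropy u) where
  continuous_mul := continuous_induced_rng.2 <|
    continuousOn_gmul.comp_continuous
      ((continuous_val.comp continuous_fst).prodMk (continuous_val.comp continuous_snd))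
      (fun z => z.1.src_val.trans z.2.rng_val.symm)
  continuous_inv := continuous_induced_rng.2 (continuous_ginv.comp continuous_val)

end Isotropy

end Groupoid

/-! ### Upper semicontinuous Banach bundles and Fell bundles -/

/-- The fibre `B(x)` of a bundle `p : E → G`. (It carries its Banach space topology, not the
subspace topology of `E`; the axioms imply that the two agree.) -/
@[ext]
structure Fibre {G : Type u} {E : Type v} (p : E → G) (x : G) : Type v where
  val : E
  proj_val : p val = x

/-- An element of the total space, viewed as an element of a fibre. -/
def inFibre {G : Type u} {E : Type v} {p : E → G} {x : G} (b : E) (h : p b = x) : Fibre p x :=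
  ⟨b, h⟩

/-- An upper semicontinuous Banach bundle `p : E → G`. -/
class USCBanachBundle {G : Type u} [TopologicalSpace G] {E : Type v} [TopologicalSpace E]
    (p : E → G) where
  fibreGroup : ∀ x, NormedAddCommGroup (Fibre p x)
  fibreSpace : ∀ x, NormedSpace ℂ (Fibre p x)
  fibreComplete : ∀ x, CompleteSpace (Fibre p x)
  continuous_proj : Continuous p
  isOpenMap_proj : IsOpenMap p
  surjective_proj : Function.Surjective p
  usc_norm : UpperSemicontinuous fun b : E => ‖inFibre (p := p) b rfl‖
  continuous_add : Continuous fun z : {z : E × E // p z.1 = p z.2} =>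
    (inFibre (p := p) z.1.1 rfl + inFibre z.1.2 z.2.symm).val
  continuous_smul : ∀ c : ℂ, Continuous fun b : E => (c • inFibre (p := p) b rfl).val
  le_nhds_zero : ∀ (x : G) (l : Filter E), Tendsto p l (𝓝 x) →
    Tendsto (fun b : E => ‖inFibre (p := p) b rfl‖) l (𝓝 0) → l ≤ 𝓝 (0 : Fibre p x).val

attribute [reducible, instance] USCBanachBundle.fibreGroup USCBanachBundle.fibreSpace
attribute [instance] USCBanachBundle.fibreComplete

/-- A multiplication of composable elements and an involution on a Banach bundle over a groupoid
that are compatible with the projection. (`bmul a b` is meaningful only if `p a` and `p b` are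
composable.) -/
class BundleMulStar {G : Type u} [TopologicalSpace G] [TopGroupoid G] {E : Type v}
    [TopologicalSpace E] (p : E → G) extends USCBanachBundle p where
  bmul : E → E → E
  bstar : E → E
  proj_bmul : ∀ a b, src (p a) = rng (p b) → p (bmul a b) = gmul (p a) (p b)
  proj_bstar : ∀ a, p (bstar a) = ginv (p a)

section FibreOps

variable {G : Type u} [TopologicalSpace G] [TopGroupoid G] {E : Type v} [TopologicalSpace E]
variable (p : E → G) [BundleMulStar p]

open BundleMulStar

/-- The product `B(x) × B(y) → B(z)` for composable `x`, `y` with `xy = z`. -/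
def fmul {p : E → G} [BundleMulStar p] {x y z : G} (h : src x = rng y) (hz : gmul x y = z)
    (a : Fibre p x) (b : Fibre p y) : Fibre p z :=
  ⟨bmul p a.val b.val, by
    rw [proj_bmul (p := p) _ _ (by rw [a.proj_val, b.proj_val, h]), a.proj_val, b.proj_val, hz]⟩

/-- The involution `B(x) → B(z)` for `z = x⁻¹`. -/
def fstar {p : E → G} [BundleMulStar p] {x z : G} (hz : ginv x = z) (a : Fibre p x) : Fibre p z :=
  ⟨bstar p a.val, by rw [proj_bstar (p := p), a.proj_val, hz]⟩

/-- A saturated Fell bundle over a groupoid: the fibres over units are `C*`-algebras and each fibre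
`B(x)` is a `B(r(x))`-`B(s(x))`-imprimitivity bimodule for the inner products `a b*` and `a* b`.
Positivity and fullness of the left inner product are those of the right one over `x⁻¹`. -/
class FellBundle extends BundleMulStar p where
  continuousOn_bmul : ContinuousOn (fun z : E × E => bmul z.1 z.2)
    {z | src (p z.1) = rng (p z.2)}
  continuous_bstar : Continuous bstar
  bmul_assoc : ∀ a b c, src (p a) = rng (p b) → src (p b) = rng (p c) →
    bmul (bmul a b) c = bmul a (bmul b c)
  bstar_bmul : ∀ a b, src (p a) = rng (p b) → bstar (bmul a b) = bmul (bstar b) (bstar a)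
  bstar_bstar : ∀ a, bstar (bstar a) = a
  add_fmul : ∀ {x y : G} (h : src x = rng y) (a a' : Fibre p x) (b : Fibre p y),
    fmul h rfl (a + a') b = fmul h rfl a b + fmul h rfl a' b
  fmul_add : ∀ {x y : G} (h : src x = rng y) (a : Fibre p x) (b b' : Fibre p y),
    fmul h rfl a (b + b') = fmul h rfl a b + fmul h rfl a b'
  smul_fmul : ∀ {x y : G} (h : src x = rng y) (c : ℂ) (a : Fibre p x) (b : Fibre p y),
    fmul h rfl (c • a) b = c • fmul h rfl a b
  fmul_smul : ∀ {x y : G} (h : src x = rng y) (c : ℂ) (a : Fibre p x) (b : Fibre p y),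
    fmul h rfl a (c • b) = c • fmul h rfl a b
  fstar_add : ∀ {x : G} (a b : Fibre p x), fstar rfl (a + b) = fstar rfl a + fstar rfl b
  fstar_smul : ∀ {x : G} (c : ℂ) (a : Fibre p x),
    fstar rfl (c • a) = starRingEnd ℂ c • fstar rfl a
  norm_fmul_le : ∀ {x y : G} (h : src x = rng y) (a : Fibre p x) (b : Fibre p y),
    ‖fmul h rfl a b‖ ≤ ‖a‖ * ‖b‖
  norm_fstar_fmul : ∀ {x : G} (a : Fibre p x),
    ‖fmul (src_ginv x) (ginv_gmul x) (fstar rfl a) a‖ = ‖a‖ ^ 2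
  positive : ∀ {x : G} (a : Fibre p x), ∃ c : Fibre p (src x),
    bmul (bstar a.val) a.val = bmul (bstar c.val) c.val
  full : ∀ x : G, (Submodule.span ℂ {c : Fibre p (src x) | ∃ a b : Fibre p x,
    c = fmul (src_ginv x) (ginv_gmul x) (fstar rfl a) b}).topologicalClosure = ⊤

end FibreOps

section Fell

variable {G : Type u} [TopologicalSpace G] [TopGroupoid G] {E : Type v} [TopologicalSpace E]
variable {p : E → G} [FellBundle p]

open BundleMulStar FellBundle

theorem fmul_add' {x y z : G} (h : src x = rng y) (hz : gmul x y = z) (a : Fibre p x)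
    (b b' : Fibre p y) : fmul h hz a (b + b') = fmul h hz a b + fmul h hz a b' := by
  subst hz; exact fmul_add h a b b'

theorem add_fmul' {x y z : G} (h : src x = rng y) (hz : gmul x y = z) (a a' : Fibre p x)
    (b : Fibre p y) : fmul h hz (a + a') b = fmul h hz a b + fmul h hz a' b := by
  subst hz; exact add_fmul h a a' b

theorem fmul_smul' {x y z : G} (h : src x = rng y) (hz : gmul x y = z) (c : ℂ) (a : Fibre p x)
    (b : Fibre p y) : fmul h hz a (c • b) = c • fmul h hz a b := by
  subst hz; exact fmul_smul h c a b

theorem smul_fmul' {x y z : G} (h : src x = rng y) (hz : gmul x y = z) (c : ℂ) (a : Fibre p x)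
    (b : Fibre p y) : fmul h hz (c • a) b = c • fmul h hz a b := by
  subst hz; exact smul_fmul h c a b

theorem norm_fmul_le' {x y z : G} (h : src x = rng y) (hz : gmul x y = z) (a : Fibre p x)
    (b : Fibre p y) : ‖fmul h hz a b‖ ≤ ‖a‖ * ‖b‖ := by
  subst hz; exact norm_fmul_le h a b

theorem fstar_add' {x z : G} (hz : ginv x = z) (a b : Fibre p x) :
    fstar hz (a + b) = fstar hz a + fstar hz b := by
  subst hz; exact fstar_add a b

theorem fstar_smul' {x z : G} (hz : ginv x = z) (c : ℂ) (a : Fibre p x) :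
    fstar hz (c • a) = starRingEnd ℂ c • fstar hz a := by
  subst hz; exact fstar_smul c a

theorem fstar_fstar {x z : G} (hz : ginv x = z) (hz' : ginv z = x) (a : Fibre p x) :
    fstar hz' (fstar hz a) = a := Fibre.ext (bstar_bstar a.val)

theorem norm_fibre_congr {x z : G} (h : x = z) (a : Fibre p x) (b : Fibre p z) (hab : a.val = b.val) :
    ‖a‖ = ‖b‖ := by
  subst h
  rw [Fibre.ext hab]

theorem norm_le_norm_fstar {x z : G} (hz : ginv x = z) (a : Fibre p x) : ‖a‖ ≤ ‖fstar hz a‖ := by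
  subst hz
  by_cases h : ‖a‖ = 0
  · rw [h]; exact norm_nonneg _
  · have h1 := norm_fmul_le' (src_ginv x) (ginv_gmul x) (fstar rfl a) a
    rw [norm_fstar_fmul, sq] at h1
    exact le_of_mul_le_mul_right h1 (lt_of_le_of_ne (norm_nonneg _) (Ne.symm h))

theorem norm_fstar {x z : G} (hz : ginv x = z) (a : Fibre p x) : ‖fstar hz a‖ = ‖a‖ := by
  have hz' : ginv z = x := by rw [← hz, ginv_ginv]
  refine le_antisymm ?_ (norm_le_norm_fstar hz a)
  have := norm_le_norm_fstar hz' (fstar hz a)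
  rwa [fstar_fstar hz hz'] at this

/-- The fibre `A(u) = B(u)` over a unit is a `C*`-algebra. -/
instance fibreCStarAlgebra (u : UnitSpace G) : NonUnitalCStarAlgebra (Fibre p u.1) where
  toAddCommGroup := (inferInstance : AddCommGroup (Fibre p u.1))
  toMetricSpace := (inferInstance : MetricSpace (Fibre p u.1))
  toNorm := (inferInstance : Norm (Fibre p u.1))
  toModule := (inferInstance : Module ℂ (Fibre p u.1))
  toCompleteSpace := (inferInstance : CompleteSpace (Fibre p u.1))
  dist_eq a b := by rw [dist_eq_norm, ← norm_neg, neg_sub, neg_add_eq_sub]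
  mul a b := fmul ((src_unit u).trans u.2.symm) (gmul_unit u) a b
  left_distrib a b c := fmul_add' _ _ a b c
  right_distrib a b c := add_fmul' _ _ a b c
  zero_mul a := by
    have h := smul_fmul' ((src_unit u).trans u.2.symm) (gmul_unit u) 0 (0 : Fibre p u.1) a
    rw [zero_smul, zero_smul] at h
    exact h
  mul_zero a := by
    have h := fmul_smul' ((src_unit u).trans u.2.symm) (gmul_unit u) 0 a (0 : Fibre p u.1)
    rw [zero_smul, zero_smul] at h
    exact h
  mul_assoc a b c := Fibre.ext (bmul_assoc _ _ _
    (by rw [a.proj_val, b.proj_val, src_unit, u.2]) (by rw [b.proj_val, c.proj_val, src_unit, u.2]))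
  norm_mul_le a b := norm_fmul_le' _ _ a b
  star a := fstar (ginv_unit u) a
  star_involutive a := fstar_fstar _ _ a
  star_mul a b := Fibre.ext (bstar_bmul _ _ (by rw [a.proj_val, b.proj_val, src_unit, u.2]))
  star_add a b := fstar_add' _ a b
  norm_mul_self_le a := by
    have h := norm_fstar_fmul a
    rw [← sq, ← h]
    exact le_of_eq (norm_fibre_congr (src_unit u) _ _ rfl)
  norm_smul_le c a := norm_smul_le c a
  smul_assoc c a b := smul_fmul' _ _ c a b
  smul_comm c a b := (fmul_smul' _ _ c a b).symm
  star_smul c a := fstar_smul' _ c a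

end Fell

/-! ### The Rieffel correspondence and stability groups -/

section Rieffel

variable {G : Type u} [TopologicalSpace G] [TopGroupoid G] {E : Type v} [TopologicalSpace E]
variable (p : E → G) [FellBundle p]

open BundleMulStar FellBundle

/-- The closed linear span in the fibre `B(x)` of the elements of `B(x)` that lie in `S`. -/
def closedSpan (x : G) (S : Set E) : Set E :=
  Fibre.val '' ((Submodule.span ℂ {c : Fibre p x | c.val ∈ S}).topologicalClosure :
    Set (Fibre p x))

/-- The set `B(x) · I` of products. -/
def fibreMulSet (x : G) (I : Set E) : Set E :=
  {t | ∃ d i, p d = x ∧ i ∈ I ∧ t = bmul p d i}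

/-- The Rieffel correspondence `h_x` from ideals of `A(s(x)) = B(s(x))` to ideals of
`A(r(x)) = B(r(x))` given by the imprimitivity bimodule `B(x)`:
`h_x(I) = {a ∈ B(r(x)) | a · B(x) ⊆ closure of the span of B(x) · I}`. -/
def rieffel (x : G) (I : Set E) : Set E :=
  {a | p a = rng x ∧ ∀ b, p b = x → bmul p a b ∈ closedSpan p x (fibreMulSet p x I)}

variable {p}

theorem proj_of_mem_closedSpan {x : G} {S : Set E} {b : E} (h : b ∈ closedSpan p x S) :
    p b = x := by
  obtain ⟨c, -, rfl⟩ := h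
  exact c.proj_val

theorem subset_closedSpan {x : G} {S : Set E} {b : E} (hb : p b = x) (h : b ∈ S) :
    b ∈ closedSpan p x S :=
  ⟨⟨b, hb⟩, subset_closure (Submodule.subset_span h), rfl⟩

/-- Continuous additive maps that respect scalars up to conjugation map closed spans to closed
spans. -/
theorem closedSpan_map {x z : G} {S T : Set E} (φ : Fibre p x → Fibre p z) (hc : Continuous φ)
    (hadd : ∀ a b, φ (a + b) = φ a + φ b) (hsmul : ∀ (c : ℂ) a, ∃ d : ℂ, φ (c • a) = d • φ a)
    (h : ∀ c : Fibre p x, c.val ∈ S → (φ c).val ∈ closedSpan p z T) :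
    ∀ c : Fibre p x, c.val ∈ closedSpan p x S → (φ c).val ∈ closedSpan p z T := by
  have key : ∀ c : Fibre p z, c.val ∈ closedSpan p z T ↔
      c ∈ (Submodule.span ℂ {c : Fibre p z | c.val ∈ T}).topologicalClosure := by
    intro c
    constructor
    · rintro ⟨d, hd, hdc⟩
      rwa [← Fibre.ext hdc]
    · intro hd
      exact ⟨c, hd, rfl⟩
  rintro c ⟨c', hc', hcc⟩
  obtain rfl := Fibre.ext hcc
  rw [key]
  have h0 : φ 0 = 0 := by
    have := hadd 0 0
    rw [add_zero] at this
    exact left_eq_add.1 this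
  have hs : ∀ d ∈ Submodule.span ℂ {c : Fibre p x | c.val ∈ S},
      φ d ∈ (Submodule.span ℂ {c : Fibre p z | c.val ∈ T}).topologicalClosure := by
    intro d hd
    induction hd using Submodule.span_induction with
    | mem d hd => exact (key _).1 (h d hd)
    | zero => rw [h0]; exact zero_mem _
    | add a b _ _ ha hb => rw [hadd]; exact add_mem ha hb
    | smul c a _ ha =>
      obtain ⟨d, hd⟩ := hsmul c a
      rw [hd]
      exact Submodule.smul_mem _ _ ha
  exact (closure_minimal (t := φ ⁻¹' _) hs
    ((Submodule.isClosed_topologicalClosure _).preimage hc)) hc'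

theorem closedSpan_le {x : G} {S T : Set E} (h : ∀ b, p b = x → b ∈ S → b ∈ closedSpan p x T)
    {b : E} (hb : b ∈ closedSpan p x S) : b ∈ closedSpan p x T :=
  closedSpan_map (p := p) (fun c : Fibre p x => c) continuous_id (fun _ _ => rfl)
    (fun c _ => ⟨c, rfl⟩) (fun c hc => h c.val c.proj_val hc) ⟨b, proj_of_mem_closedSpan hb⟩ hb

theorem continuous_of_bound {x z : G} (φ : Fibre p x → Fibre p z) (C : ℝ)
    (hadd : ∀ a b, φ (a + b) = φ a + φ b) (hb : ∀ a, ‖φ a‖ ≤ C * ‖a‖) : Continuous φ :=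
  AddMonoidHomClass.continuous_of_bound (AddMonoidHom.mk' φ hadd) C hb

theorem closedSpan_mul_right {x z : G} {S T : Set E} {d : E} (hd : src x = rng (p d))
    (hz : gmul x (p d) = z) (h : ∀ c, p c = x → c ∈ S → bmul p c d ∈ closedSpan p z T)
    {c : E} (hc : c ∈ closedSpan p x S) : bmul p c d ∈ closedSpan p z T := by
  refine closedSpan_map (p := p) (fun c : Fibre p x => fmul hd hz c ⟨d, rfl⟩)
    (continuous_of_bound _ ‖(⟨d, rfl⟩ : Fibre p (p d))‖ (fun a b => add_fmul' _ _ _ _ _) ?_)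
    (fun a b => add_fmul' _ _ _ _ _) (fun c a => ⟨c, smul_fmul' _ _ _ _ _⟩)
    (fun c hc => h c.val c.proj_val hc) ⟨c, proj_of_mem_closedSpan hc⟩ hc
  intro a
  rw [mul_comm]
  exact norm_fmul_le' _ _ _ _

theorem closedSpan_mul_left {y z : G} {S T : Set E} {d : E} (hd : src (p d) = rng y)
    (hz : gmul (p d) y = z) (h : ∀ c, p c = y → c ∈ S → bmul p d c ∈ closedSpan p z T)
    {c : E} (hc : c ∈ closedSpan p y S) : bmul p d c ∈ closedSpan p z T := by
  refine closedSpan_map (p := p) (fun c : Fibre p y => fmul hd hz ⟨d, rfl⟩ c)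
    (continuous_of_bound _ ‖(⟨d, rfl⟩ : Fibre p (p d))‖ (fun a b => fmul_add' _ _ _ _ _) ?_)
    (fun a b => fmul_add' _ _ _ _ _) (fun c a => ⟨c, fmul_smul' _ _ _ _ _⟩)
    (fun c hc => h c.val c.proj_val hc) ⟨c, proj_of_mem_closedSpan hc⟩ hc
  intro a
  exact norm_fmul_le' _ _ _ _

theorem closedSpan_star {x z : G} {S T : Set E} (hz : ginv x = z)
    (h : ∀ c, p c = x → c ∈ S → bstar p c ∈ closedSpan p z T)
    {c : E} (hc : c ∈ closedSpan p x S) : bstar p c ∈ closedSpan p z T := by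
  refine closedSpan_map (p := p) (fun c : Fibre p x => fstar hz c)
    (continuous_of_bound _ 1 (fun a b => fstar_add' _ _ _) ?_)
    (fun a b => fstar_add' _ _ _) (fun c a => ⟨_, fstar_smul' _ _ _⟩)
    (fun c hc => h c.val c.proj_val hc) ⟨c, proj_of_mem_closedSpan hc⟩ hc
  intro a
  rw [norm_fstar, one_mul]

theorem exists_approx_unit {R : Type*} [NonUnitalCStarAlgebra R] (m : R) {ε : ℝ} (hε : 0 < ε) :
    ∃ e : R, ‖e‖ ≤ 1 ∧ ‖m - m * e‖ < ε := by
  let _ := CStarAlgebra.spectralOrder R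
  let _ := CStarAlgebra.spectralOrderedRing R
  have h := CStarAlgebra.increasingApproximateUnit R
  have h1 := h.tendsto_mul_left m
  have h2 := h.eventually_norm
  have h3 := Metric.tendsto_nhds.1 h1 ε hε
  have := h.neBot
  obtain ⟨e, he1, he2⟩ := (h2.and h3).exists
  exact ⟨e, he1, by rwa [← dist_eq_norm, dist_comm]⟩

theorem fmul_sub' {x y z : G} (h : src x = rng y) (hz : gmul x y = z) (a : Fibre p x)
    (b b' : Fibre p y) : fmul h hz a (b - b') = fmul h hz a b - fmul h hz a b' :=
  (AddMonoidHom.mk' _ (fmul_add' h hz a)).map_sub b b'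

theorem sub_fmul' {x y z : G} (h : src x = rng y) (hz : gmul x y = z) (a a' : Fibre p x)
    (b : Fibre p y) : fmul h hz (a - a') b = fmul h hz a b - fmul h hz a' b :=
  (AddMonoidHom.mk' (fun a => fmul h hz a b) (fun a a' => add_fmul' h hz a a' b)).map_sub a a'

theorem fstar_sub' {x z : G} (hz : ginv x = z) (a b : Fibre p x) :
    fstar hz (a - b) = fstar hz a - fstar hz b :=
  (AddMonoidHom.mk' (fun a => fstar hz a) (fstar_add' hz)).map_sub a b

theorem exists_approx_fibre (u : UnitSpace G) (m : Fibre p u.1) {ε : ℝ} (hε : 0 < ε) :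
    ∃ e : Fibre p u.1, ‖e‖ ≤ 1 ∧
      ‖m - fmul ((src_unit u).trans u.2.symm) (gmul_unit u) m e‖ < ε :=
  exists_approx_unit (R := Fibre p u.1) m hε

theorem exists_approx_right {x : G} (b : Fibre p x) {ε : ℝ} (hε : 0 < ε) :
    ∃ e : Fibre p (src x),
      ‖b - fmul (rng_src x).symm (self_gmul_src x) b e‖ ^ 2 < ε := by
  let m : Fibre p (src x) := fmul (src_ginv x) (ginv_gmul x) (fstar rfl b) b
  have hs : src (src x) = rng (src x) := by rw [src_src, rng_src]
  have hss : gmul (src x) (src x) = src x := gmul_unit ⟨src x, rng_src x⟩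
  obtain ⟨e, he, hm⟩ := exists_approx_fibre ⟨src x, rng_src x⟩ m (ε := ε / 2) (by positivity)
  change ‖m - fmul hs hss m e‖ < ε / 2 at hm
  refine ⟨e, ?_⟩
  set f : Fibre p x := fmul (rng_src x).symm (self_gmul_src x) b e with hf
  have h1 : fmul (src_ginv x) (ginv_gmul x) (fstar rfl b) (b - f) =
      m - fmul hs hss m e := by
    rw [fmul_sub']
    congr 1
    refine Fibre.ext ?_
    refine (bmul_assoc (p := p) _ _ _ ?_ ?_).symm
    · rw [(fstar rfl b).proj_val, b.proj_val, src_ginv]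
    · rw [b.proj_val, e.proj_val, rng_src]
  have h2 : fmul (src_ginv x) (ginv_gmul x) (fstar rfl f) (b - f) =
      fmul hs hss (fstar (ginv_unit ⟨src x, rng_src x⟩) e) (m - fmul hs hss m e) := by
    rw [← h1]
    refine Fibre.ext ?_
    change bmul p (bstar p (bmul p b.val e.val)) _ = bmul p (bstar p e.val) (bmul p _ _)
    rw [bstar_bmul (p := p) _ _ (by rw [b.proj_val, e.proj_val, rng_src])]
    refine bmul_assoc (p := p) _ _ _ ?_ ?_
    · rw [proj_bstar (p := p), proj_bstar (p := p), b.proj_val, e.proj_val, src_ginv, rng_ginv,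
        rng_src]
    · rw [proj_bstar (p := p), b.proj_val, src_ginv, (b - f).proj_val]
  rw [← norm_fstar_fmul, fstar_sub', sub_fmul', h1, h2]
  set w := m - fmul hs hss m e with hw
  have h3 := norm_fmul_le' hs hss (fstar (ginv_unit ⟨src x, rng_src x⟩) e) w
  rw [norm_fstar] at h3
  have h4 : ‖e‖ * ‖w‖ ≤ ‖w‖ := mul_le_of_le_one_left (norm_nonneg _) he
  refine lt_of_le_of_lt (norm_sub_le _ _) ?_
  linarith

/-- `b` lies in the closed span of the products `b c* d` with `c`, `d` in a fixed fibre. -/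
theorem mem_closedSpan_mul_right {x y : G} (hxy : src y = src x) {b : E} (hb : p b = x) :
    b ∈ closedSpan p x {t | ∃ c d, p c = y ∧ p d = y ∧ t = bmul p b (bmul p (bstar p c) d)} := by
  subst hb
  set T := {t | ∃ c d, p c = y ∧ p d = y ∧ t = bmul p b (bmul p (bstar p c) d)} with hT
  have hfull : ∀ e : E, p e = src (p b) →
      e ∈ closedSpan p (src (p b)) {t | ∃ c d, p c = y ∧ p d = y ∧ t = bmul p (bstar p c) d} := by
    rw [← hxy]
    intro e he
    have h := FellBundle.full (p := p) y
    have h' : (⟨e, he⟩ : Fibre p (src y)) ∈ (Submodule.span ℂ {c : Fibre p (src y) |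
        ∃ a b : Fibre p y, c = fmul (src_ginv y) (ginv_gmul y) (fstar rfl a) b}).topologicalClosure
        := by rw [h]; trivial
    refine ⟨_, Submodule.topologicalClosure_mono (Submodule.span_mono ?_) h', rfl⟩
    rintro c ⟨a, b, rfl⟩
    exact ⟨a.val, b.val, a.proj_val, b.proj_val, rfl⟩
  have key : ∀ e : E, p e = src (p b) → bmul p b e ∈ closedSpan p (p b) T := by
    intro e he
    refine closedSpan_mul_left (rng_src _).symm (self_gmul_src _) ?_ (hfull e he)
    rintro c hc ⟨c', d', hc', hd', rfl⟩
    refine subset_closedSpan ?_ ⟨c', d', hc', hd', rfl⟩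
    rw [proj_bmul (p := p) _ _ (by rw [hc, rng_src]), hc, self_gmul_src]
  refine ⟨⟨b, rfl⟩, ?_, rfl⟩
  rw [← (Submodule.isClosed_topologicalClosure _).closure_eq, Metric.mem_closure_iff]
  intro ε hε
  obtain ⟨e, he⟩ := exists_approx_right (⟨b, rfl⟩ : Fibre p (p b)) (ε := ε ^ 2) (by positivity)
  obtain ⟨w, hw, hw'⟩ := key e.val e.proj_val
  refine ⟨w, hw, ?_⟩
  rw [dist_eq_norm]
  have : w = fmul (rng_src (p b)).symm (self_gmul_src (p b)) (⟨b, rfl⟩ : Fibre p (p b)) e :=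
    Fibre.ext hw'
  rw [this]
  exact lt_of_pow_lt_pow_left₀ 2 hε.le he

theorem mem_closedSpan_mul_left {x y : G} (hxy : rng y = rng x) {b : E} (hb : p b = x) :
    b ∈ closedSpan p x {t | ∃ c d, p c = y ∧ p d = y ∧ t = bmul p (bmul p c (bstar p d)) b} := by
  have h := mem_closedSpan_mul_right (p := p) (x := ginv x) (y := ginv y)
    (by rw [src_ginv, src_ginv, hxy]) (b := bstar p b) (by rw [proj_bstar (p := p), hb])
  have h2 := closedSpan_star (p := p) (z := x)
    (T := {t | ∃ c d, p c = y ∧ p d = y ∧ t = bmul p (bmul p c (bstar p d)) b})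
    (ginv_ginv x) ?_ h
  · rwa [bstar_bstar] at h2
  · rintro t ht ⟨c, d, hc, hd, rfl⟩
    have e1 : p (bstar p c) = y := by rw [proj_bstar (p := p), hc, ginv_ginv]
    have e2 : p (bstar p d) = y := by rw [proj_bstar (p := p), hd, ginv_ginv]
    have e3 : bstar p (bmul p (bstar p b) (bmul p (bstar p c) d)) =
        bmul p (bmul p (bstar p d) (bstar p (bstar p c))) b := by
      rw [bstar_bmul (p := p), bstar_bmul (p := p), bstar_bstar (p := p) b]
      · rw [e1, hd, rng_ginv]
      · rw [proj_bstar (p := p), hb, src_ginv, proj_bmul (p := p), e1, hd, rng_gmul, hxy]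
        · rw [rng_ginv]
        · rw [e1, hd, rng_ginv]
    have e4 : p (bstar p (bmul p (bstar p b) (bmul p (bstar p c) d))) = x := by
      rw [proj_bstar (p := p), ht, ginv_ginv]
    refine subset_closedSpan e4 ⟨bstar p d, bstar p c, e2, e1, e3⟩

/-- `J` is a closed two-sided ideal of `A(u) = B(u)`, regarded as a subset of the total space. -/
structure IsClosedFibreIdeal (p : E → G) [FellBundle p] (u : UnitSpace G) (J : Set E) : Prop where
  proj_eq : ∀ a ∈ J, p a = u.1
  mul_left : ∀ a ∈ J, ∀ b, p b = u.1 → bmul p b a ∈ J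
  mul_right : ∀ a ∈ J, ∀ b, p b = u.1 → bmul p a b ∈ J
  closed : ∀ a ∈ closedSpan p u.1 J, a ∈ J

theorem mulSet_mem {x : G} {J : Set E} {d i : E} (hd : p d = x) (hi : i ∈ J)
    (h : p (bmul p d i) = x) : bmul p d i ∈ closedSpan p x (fibreMulSet p x J) :=
  subset_closedSpan h ⟨d, i, hd, hi, rfl⟩

theorem rieffel_unit {u : UnitSpace G} {J : Set E} (hJ : IsClosedFibreIdeal p u J) :
    rieffel p u.1 J = J := by
  have hu := src_unit u
  have hu' := gmul_unit u
  have hu2 := u.2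
  ext a
  constructor
  · rintro ⟨ha, hab⟩
    rw [u.2] at ha
    refine hJ.closed a (closedSpan_le ?_ (mem_closedSpan_mul_right (y := u.1) rfl ha))
    rintro t ht ⟨c, d, hc, hd, rfl⟩
    have h := hab (bmul p (bstar p c) d) (by
      rw [proj_bmul (p := p), proj_bstar (p := p), hc, hd, ginv_unit, hu']
      rw [proj_bstar (p := p), hc, hd, ginv_unit, hu, hu2])
    refine closedSpan_le ?_ h
    rintro t ht ⟨d, i, hd, hi, rfl⟩
    exact subset_closedSpan ht (hJ.mul_left i hi d hd)
  · intro ha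
    have hpa := hJ.proj_eq a ha
    refine ⟨by rw [hpa, u.2], fun b hb => ?_⟩
    have hab : bmul p a b ∈ J := hJ.mul_right a ha b hb
    have hpab := hJ.proj_eq _ hab
    refine closedSpan_le ?_ (mem_closedSpan_mul_left (y := u.1) rfl hpab)
    rintro t ht ⟨c, d, hc, hd, rfl⟩
    refine subset_closedSpan ht ⟨_, _, ?_, hab, rfl⟩
    rw [proj_bmul (p := p), proj_bstar (p := p), hc, hd, ginv_unit, hu']
    rw [proj_bstar (p := p), hc, hd, ginv_unit, hu, hu2]

section Stab

variable {u : UnitSpace G} {J : Set E} {x y z : Isotropy u} {a b c : E}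

theorem iso_proj (ha : p a = x.val) (hb : p b = y.val) (hz : x * y = z) :
    p (bmul p a b) = z.val := by
  rw [proj_bmul (p := p) _ _ (by rw [ha, hb, x.src_val, y.rng_val]), ha, hb, ← hz]
  rfl

theorem iso_star (ha : p a = x.val) (hz : x⁻¹ = z) : p (bstar p a) = z.val := by
  rw [proj_bstar (p := p), ha, ← hz]
  rfl

theorem iso_assoc (ha : p a = x.val) (hb : p b = y.val) (hc : p c = z.val) :
    bmul p (bmul p a b) c = bmul p a (bmul p b c) :=
  bmul_assoc (p := p) _ _ _ (by rw [ha, hb, x.src_val, y.rng_val])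
    (by rw [hb, hc, y.src_val, z.rng_val])

theorem iso_span_left {S T : Set E} (ha : p a = x.val) (hz : x * y = z)
    (h : ∀ c, p c = y.val → c ∈ S → bmul p a c ∈ closedSpan p z.val T)
    (hc : c ∈ closedSpan p y.val S) : bmul p a c ∈ closedSpan p z.val T :=
  closedSpan_mul_left (by rw [ha, x.src_val, y.rng_val]) (by rw [ha, ← hz]; rfl) h hc

theorem iso_span_right {S T : Set E} (ha : p a = x.val) (hz : y * x = z)
    (h : ∀ c, p c = y.val → c ∈ S → bmul p c a ∈ closedSpan p z.val T)
    (hc : c ∈ closedSpan p y.val S) : bmul p c a ∈ closedSpan p z.val T :=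
  closedSpan_mul_right (by rw [ha, x.rng_val, y.src_val]) (by rw [ha, ← hz]; rfl) h hc

theorem iso_approx_right (y : Isotropy u) (hb : p b = x.val) : b ∈ closedSpan p x.val
    {t | ∃ c d, p c = y.val ∧ p d = y.val ∧ t = bmul p b (bmul p (bstar p c) d)} :=
  mem_closedSpan_mul_right (by rw [x.src_val, y.src_val]) hb

theorem iso_approx_left (y : Isotropy u) (hb : p b = x.val) : b ∈ closedSpan p x.val
    {t | ∃ c d, p c = y.val ∧ p d = y.val ∧ t = bmul p (bmul p c (bstar p d)) b} :=
  mem_closedSpan_mul_left (by rw [x.rng_val, y.rng_val]) hb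

theorem IsClosedFibreIdeal.proj (hJ : IsClosedFibreIdeal p u J) (ha : a ∈ J) :
    p a = (1 : Isotropy u).val := hJ.proj_eq a ha

theorem iso_mem_mulSet (hJ : IsClosedFibreIdeal p u J) (ha : p a = x.val) (hb : b ∈ J) :
    bmul p a b ∈ closedSpan p x.val (fibreMulSet p x.val J) :=
  subset_closedSpan (iso_proj ha (hJ.proj hb) (mul_one x)) ⟨a, b, ha, hb, rfl⟩

theorem iso_act (hx : rieffel p x.val J = J) (ha : a ∈ J) (hb : p b = x.val) :
    bmul p a b ∈ closedSpan p x.val (fibreMulSet p x.val J) := by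
  rw [← hx] at ha
  exact ha.2 b hb

theorem IsClosedFibreIdeal.mem (hJ : IsClosedFibreIdeal p u J)
    (ha : a ∈ closedSpan p (1 : Isotropy u).val J) : a ∈ J := hJ.closed a ha

theorem IsClosedFibreIdeal.mem_span (hJ : IsClosedFibreIdeal p u J) (ha : a ∈ J) :
    a ∈ closedSpan p (1 : Isotropy u).val J := subset_closedSpan (hJ.proj ha) ha

/-- If `h_x(J) = J` then `a b c` is in `J` for `a` in `B(x)`, `b` in `J` and `c` in `B(x⁻¹)`. -/
theorem conj_mem (hJ : IsClosedFibreIdeal p u J) (hx : rieffel p x.val J = J)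
    (ha : p a = x.val) (hb : b ∈ J) (hc : p c = (x⁻¹).val) : bmul p (bmul p a b) c ∈ J := by
  have hpb := hJ.proj hb
  have hab := iso_proj ha hpb (mul_one x)
  rw [← hx]
  refine ⟨by rw [iso_proj hab hc (mul_inv_cancel x), x.rng_val]; rfl, fun d hd => ?_⟩
  have hcd := iso_proj hc hd (inv_mul_cancel x)
  rw [iso_assoc hab hc hd, iso_assoc ha hpb hcd]
  exact iso_mem_mulSet hJ ha (hJ.mul_right b hb _ hcd)

theorem stab_mul (hJ : IsClosedFibreIdeal p u J) (hx : rieffel p x.val J = J)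
    (hy : rieffel p y.val J = J) : rieffel p (x * y).val J = J := by
  ext a
  constructor
  · rintro ⟨ha, hab⟩
    replace ha : p a = (1 : Isotropy u).val := by rw [ha, (x * y).rng_val]; rfl
    rw [← hx]
    refine ⟨by rw [ha, x.rng_val]; rfl, fun b hb => ?_⟩
    have hpab := iso_proj ha hb (one_mul x)
    refine closedSpan_le ?_ (iso_approx_right (y⁻¹) hpab)
    rintro _ - ⟨c, d, hc, hd, rfl⟩
    have hcs := iso_star hc (inv_inv y)
    have hbc := iso_proj hb hcs rfl
    rw [← iso_assoc hpab hcs hd, iso_assoc ha hb hcs]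
    refine iso_span_right hd (mul_inv_cancel_right x y) ?_ (hab _ hbc)
    rintro _ - ⟨w, i, hw, hi, rfl⟩
    have hpi := hJ.proj hi
    have hid := iso_proj hpi hd (one_mul _)
    rw [iso_assoc hw hpi hd]
    refine iso_span_right hid (mul_inv_cancel_right x y) ?_ (iso_approx_right y hw)
    rintro _ - ⟨e, f, he, hf, rfl⟩
    have hes := iso_star he rfl
    have hwe := iso_proj hw hes (mul_inv_cancel_right x y)
    rw [← iso_assoc hw hes hf, iso_assoc hwe hf hid, ← iso_assoc hf hpi hd]
    exact iso_mem_mulSet hJ hwe (conj_mem hJ hy hf hi hd)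
  · intro ha
    have hpa := hJ.proj ha
    refine ⟨by rw [hpa, (x * y).rng_val]; rfl, fun c hc => ?_⟩
    refine iso_span_left hpa (one_mul (x * y)) ?_ (iso_approx_right y hc)
    rintro _ - ⟨b, d, hb, hd, rfl⟩
    have hbs := iso_star hb rfl
    have hcb := iso_proj hc hbs (mul_inv_cancel_right x y)
    rw [← iso_assoc hc hbs hd, ← iso_assoc hpa hcb hd]
    refine iso_span_right hd rfl ?_ (iso_act hx ha hcb)
    rintro _ - ⟨e, i, he, hi, rfl⟩
    rw [iso_assoc he (hJ.proj hi) hd]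
    refine iso_span_left he rfl ?_ (iso_act hy hi hd)
    rintro _ - ⟨f, j, hf, hj, rfl⟩
    rw [← iso_assoc he hf (hJ.proj hj)]
    exact iso_mem_mulSet hJ (iso_proj he hf rfl) hj

theorem stab_inv (hJ : IsClosedFibreIdeal p u J) (hx : rieffel p x.val J = J) :
    rieffel p (x⁻¹).val J = J := by
  ext a
  constructor
  · rintro ⟨ha, hab⟩
    replace ha : p a = (1 : Isotropy u).val := by rw [ha, (x⁻¹).rng_val]; rfl
    have conj : ∀ c d, p c = x.val → p d = (x⁻¹).val → bmul p c (bmul p a d) ∈ J := by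
      intro c d hc hd
      refine hJ.mem (iso_span_left hc (mul_inv_cancel x) ?_ (hab d hd))
      rintro _ - ⟨e, i, he, hi, rfl⟩
      rw [← iso_assoc hc he (hJ.proj hi)]
      exact hJ.mem_span (hJ.mul_left i hi _ (iso_proj hc he (mul_inv_cancel x)))
    refine hJ.mem (closedSpan_le ?_ (iso_approx_right x ha))
    rintro t ht ⟨c, d, hc, hd, rfl⟩
    refine closedSpan_le ?_ (iso_approx_left (x⁻¹) ht)
    rintro _ - ⟨e, f, he, hf, rfl⟩
    have hcs := iso_star hc rfl
    have hfs := iso_star hf (inv_inv x)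
    have hac := iso_proj ha hcs (one_mul _)
    rw [← iso_assoc ha hcs hd, iso_assoc he hfs (iso_proj hac hd rfl), ← iso_assoc hfs hac hd]
    refine hJ.mem_span (hJ.mem (iso_span_left he (inv_mul_cancel x) ?_
      (iso_act hx (conj _ _ hfs hcs) hd)))
    rintro _ - ⟨w, i, hw, hi, rfl⟩
    rw [← iso_assoc he hw (hJ.proj hi)]
    exact hJ.mem_span (hJ.mul_left i hi _ (iso_proj he hw (inv_mul_cancel x)))
  · intro ha
    have hpa := hJ.proj ha
    refine ⟨by rw [hpa, (x⁻¹).rng_val]; rfl, fun b hb => ?_⟩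
    have hab := iso_proj hpa hb (one_mul _)
    refine closedSpan_le ?_ (iso_approx_left (x⁻¹) hab)
    rintro _ - ⟨c, d, hc, hd, rfl⟩
    have hds := iso_star hd (inv_inv x)
    rw [iso_assoc hc hds hab, ← iso_assoc hds hpa hb]
    exact iso_mem_mulSet hJ hc (conj_mem hJ hx hds ha hb)

end Stab

end Rieffel

/-! ### Sections, the `C*`-algebra over the unit space, and stability groups of primitive ideals -/

section Sections

variable {G : Type u} [TopologicalSpace G] [TopGroupoid G] {E : Type v} [TopologicalSpace E]
variable {p : E → G} [FellBundle p] {X : Type*} [TopologicalSpace X] {φ : X → G}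

open BundleMulStar FellBundle

/-- Continuity of a section of the pull-back of the bundle `p : E → G` along `φ : X → G`. -/
def IsContinuousSection (f : ∀ x, Fibre p (φ x)) : Prop := Continuous fun x => (f x).val

/-- A section vanishes at infinity if its norm does. -/
def VanishesAtInfinity (f : ∀ x, Fibre p (φ x)) : Prop :=
  Tendsto (fun x => ‖f x‖) (cocompact X) (𝓝 0)

/-- A section has compact support if it is zero off a compact set. -/
def IsCompactlySupported (f : ∀ x, Fibre p (φ x)) : Prop :=
  ∃ C : Set X, IsCompact C ∧ ∀ x, x ∉ C → f x = 0

variable (p) in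
/-- A Fell bundle is separable if the Banach space `Γ₀(G, E)` of continuous sections vanishing at
infinity is separable in the supremum norm. -/
def IsSeparableBundle : Prop :=
  ∃ D : Set (∀ x : G, Fibre p x), D.Countable ∧
    (∀ g ∈ D, IsContinuousSection (φ := id) g ∧ VanishesAtInfinity (φ := id) g) ∧
    ∀ f : ∀ x : G, Fibre p x, IsContinuousSection (φ := id) f → VanishesAtInfinity (φ := id) f →
      ∀ ε > 0, ∃ g ∈ D, ∀ x, ‖f x - g x‖ < ε

theorem val_add_eq {x : G} (a b : Fibre p x) :
    (a + b).val = (inFibre (p := p) a.val rfl +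
      inFibre b.val (b.proj_val.trans a.proj_val.symm)).val := by
  obtain ⟨a, rfl⟩ := a
  rfl

theorem val_smul_eq {x : G} (c : ℂ) (a : Fibre p x) :
    (c • a).val = (c • inFibre (p := p) a.val rfl).val := by
  obtain ⟨a, rfl⟩ := a
  rfl

theorem IsContinuousSection.add {f g : ∀ x, Fibre p (φ x)} (hf : IsContinuousSection f)
    (hg : IsContinuousSection g) : IsContinuousSection (f + g) := by
  have h : Continuous fun x => (⟨((f x).val, (g x).val),
      (f x).proj_val.trans (g x).proj_val.symm⟩ : {z : E × E // p z.1 = p z.2}) :=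
    Continuous.subtype_mk (hf.prodMk hg) _
  exact (USCBanachBundle.continuous_add.comp h).congr fun x => (val_add_eq (f x) (g x)).symm

theorem IsContinuousSection.smul {f : ∀ x, Fibre p (φ x)} (hf : IsContinuousSection f) (c : ℂ) :
    IsContinuousSection (c • f) :=
  ((USCBanachBundle.continuous_smul (p := p) c).comp hf).congr fun x => (val_smul_eq c (f x)).symm

theorem IsContinuousSection.zero (hφ : Continuous φ) :
    IsContinuousSection (0 : ∀ x, Fibre p (φ x)) := by
  refine continuous_iff_continuousAt.2 fun x => ?_
  refine USCBanachBundle.le_nhds_zero (φ x) _ ?_ ?_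
  · refine tendsto_map'_iff.2 ?_
    exact (hφ.tendsto x).congr fun y => ((0 : Fibre p (φ y)).proj_val).symm
  · refine tendsto_map'_iff.2 ?_
    refine tendsto_const_nhds.congr fun y => ?_
    have h : ‖inFibre (p := p) (0 : Fibre p (φ y)).val rfl‖ = ‖(0 : Fibre p (φ y))‖ :=
      norm_fibre_congr (0 : Fibre p (φ y)).proj_val _ _ rfl
    exact (h.trans norm_zero).symm

variable (p) in
/-- The `C*`-algebra `A = Γ₀(G⁽⁰⁾, E)` of continuous sections over the unit space that vanish at
infinity, with the pointwise operations. (Its `C*`-norm is the supremum norm; the notions used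
below depend only on the `*`-algebra.) -/
def sectionAlgebra : NonUnitalStarSubalgebra ℂ (∀ u : UnitSpace G, Fibre p u.1) where
  carrier := {f | IsContinuousSection (φ := fun u : UnitSpace G => u.1) f ∧
    VanishesAtInfinity (φ := fun u : UnitSpace G => u.1) f}
  add_mem' := by
    rintro f g ⟨hf, hf'⟩ ⟨hg, hg'⟩
    refine ⟨IsContinuousSection.add (φ := fun u : UnitSpace G => u.1) hf hg, ?_⟩
    refine squeeze_zero (fun _ => norm_nonneg _) (fun u => norm_add_le (f u) (g u)) ?_
    simpa using Tendsto.add hf' hg'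
  zero_mem' := by
    refine ⟨IsContinuousSection.zero (φ := fun u : UnitSpace G => u.1) continuous_subtype_val, ?_⟩
    exact tendsto_const_nhds.congr fun u => (norm_zero (E := Fibre p u.1)).symm
  mul_mem' := by
    rintro f g ⟨hf, hf'⟩ ⟨hg, hg'⟩
    refine ⟨?_, ?_⟩
    · refine (FellBundle.continuousOn_bmul (p := p)).comp_continuous (hf.prodMk hg) fun u => ?_
      change src (p (f u).val) = rng (p (g u).val)
      rw [(f u).proj_val, (g u).proj_val, src_unit, u.2]
    · refine squeeze_zero (fun _ => norm_nonneg _) (fun u => norm_mul_le (f u) (g u)) ?_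
      simpa using Tendsto.mul hf' hg'
  smul_mem' := by
    rintro c f ⟨hf, hf'⟩
    refine ⟨IsContinuousSection.smul (φ := fun u : UnitSpace G => u.1) hf c, ?_⟩
    have h : Tendsto (fun u => ‖c‖ * ‖f u‖) (cocompact (UnitSpace G)) (𝓝 (‖c‖ * 0)) :=
      Tendsto.const_mul _ hf'
    rw [mul_zero] at h
    exact h.congr fun u => (norm_smul c (f u)).symm
  star_mem' := by
    rintro f ⟨hf, hf'⟩
    refine ⟨(FellBundle.continuous_bstar (p := p)).comp hf, ?_⟩
    exact hf'.congr fun u => (norm_star (f u)).symm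

/-- The relation `u = σ_A(P)`: `u` is the (unique) unit such that `P` contains the ideal
`I(u) = {f ∈ A | f(u) = 0}`, the kernel of `A → A(u)`. -/
def IsStructurePoint (P : Prim (sectionAlgebra p)) (u : UnitSpace G) : Prop :=
  ∀ f : sectionAlgebra p, f.1 u = 0 → f ∈ P.1

/-- An ideal `P` of `A` viewed as an ideal of `A(u) = B(u)`: the closed two-sided ideal generated by
the image of `P` under `f ↦ f(u)`. (When `P` contains the kernel of this map, it is that image,
because the map is surjective and the image of a closed ideal is closed.) -/
def idealAt (P : Prim (sectionAlgebra p)) (u : UnitSpace G) : TwoSidedIdeal (Fibre p u.1) :=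
  sInf {J | IsClosed (J : Set (Fibre p u.1)) ∧ ∀ f ∈ P.1, f.1 u ∈ J}

theorem isClosed_idealAt (P : Prim (sectionAlgebra p)) (u : UnitSpace G) :
    IsClosed (idealAt P u : Set (Fibre p u.1)) := by
  have h : (idealAt P u : Set (Fibre p u.1)) =
      ⋂ J ∈ {J : TwoSidedIdeal (Fibre p u.1) |
        IsClosed (J : Set (Fibre p u.1)) ∧ ∀ f ∈ P.1, f.1 u ∈ J}, (J : Set (Fibre p u.1)) := by
    ext a
    simp only [idealAt, SetLike.mem_coe, TwoSidedIdeal.mem_sInf, Set.mem_iInter]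
  rw [h]
  exact isClosed_biInter fun J hJ => hJ.1

theorem smul_mem_of_isClosed {R : Type*} [NonUnitalCStarAlgebra R] {J : TwoSidedIdeal R}
    (hJ : IsClosed (J : Set R)) (c : ℂ) {a : R} (ha : a ∈ J) : c • a ∈ J := by
  rw [← SetLike.mem_coe, ← hJ.closure_eq, Metric.mem_closure_iff]
  intro ε hε
  obtain ⟨e, -, he⟩ := exists_approx_unit (c • a) hε
  refine ⟨c • a * e, ?_, by rwa [dist_eq_norm]⟩
  rw [smul_mul_assoc, ← mul_smul_comm]
  exact J.mul_mem_right _ _ ha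

theorem isClosedFibreIdeal_of_isClosed {u : UnitSpace G} {J : TwoSidedIdeal (Fibre p u.1)}
    (hJ : IsClosed (J : Set (Fibre p u.1))) :
    IsClosedFibreIdeal p u (Fibre.val '' (J : Set (Fibre p u.1))) where
  proj_eq := by
    rintro _ ⟨a, -, rfl⟩
    exact a.proj_val
  mul_left := by
    rintro _ ⟨a, ha, rfl⟩ b hb
    exact ⟨(⟨b, hb⟩ : Fibre p u.1) * a, J.mul_mem_left _ _ ha, rfl⟩
  mul_right := by
    rintro _ ⟨a, ha, rfl⟩ b hb
    exact ⟨a * (⟨b, hb⟩ : Fibre p u.1), J.mul_mem_right _ _ ha, rfl⟩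
  closed := by
    rintro _ ⟨a, ha, rfl⟩
    refine ⟨a, ?_, rfl⟩
    refine closure_minimal ?_ hJ ha
    intro b hb
    induction hb using Submodule.span_induction with
    | mem b hb =>
      obtain ⟨b', hb', h⟩ := hb
      rwa [← Fibre.ext h]
    | zero => exact J.zero_mem
    | add a b _ _ ha hb => exact J.add_mem ha hb
    | smul c a _ ha => exact smul_mem_of_isClosed hJ c ha

/-- The stability group `G_P` of a primitive ideal `P` with `σ_A(P) = u`: the subgroup of those `x`
in `G(u)` such that `x · P = P`, where `x · P` is given by the Rieffel correspondence `h_x`. -/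
def stabilityGroup (P : Prim (sectionAlgebra p)) (u : UnitSpace G) : Subgroup (Isotropy u) where
  carrier := {x | rieffel p x.val (Fibre.val '' (idealAt P u : Set (Fibre p u.1))) =
    Fibre.val '' (idealAt P u : Set (Fibre p u.1))}
  mul_mem' hx hy := stab_mul (isClosedFibreIdeal_of_isClosed (isClosed_idealAt P u)) hx hy
  one_mem' := rieffel_unit (isClosedFibreIdeal_of_isClosed (isClosed_idealAt P u))
  inv_mem' hx := stab_inv (isClosedFibreIdeal_of_isClosed (isClosed_idealAt P u)) hx

end Sections

/-! ### The `C*`-algebra of the restriction of a Fell bundle to a subgroup of an isotropy group -/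

section GroupBundle

variable {G : Type u} [TopologicalSpace G] [TopGroupoid G] {E : Type v} [TopologicalSpace E]
variable (p : E → G) [FellBundle p] {u : UnitSpace G} (K : Subgroup (Isotropy u))

open BundleMulStar FellBundle

/-- `Γ_c(K, E)`: the compactly supported continuous sections of the restriction of the bundle to
`K`. -/
def sectionsC : Submodule ℂ (∀ k : K, Fibre p k.1.val) where
  carrier := {f | IsContinuousSection (φ := fun k : K => k.1.val) f ∧
    IsCompactlySupported (φ := fun k : K => k.1.val) f}
  add_mem' := by
    rintro f g ⟨hf, C, hC, hf'⟩ ⟨hg, D, hD, hg'⟩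
    refine ⟨IsContinuousSection.add (φ := fun k : K => k.1.val) hf hg, C ∪ D, hC.union hD, ?_⟩
    intro x hx
    have h1 := hf' x fun h => hx (Or.inl h)
    have h2 := hg' x fun h => hx (Or.inr h)
    simp [h1, h2]
  zero_mem' := ⟨IsContinuousSection.zero (φ := fun k : K => k.1.val)
    (Isotropy.continuous_val.comp continuous_subtype_val), ∅, isCompact_empty, fun _ _ => rfl⟩
  smul_mem' := by
    rintro c f ⟨hf, C, hC, hf'⟩
    refine ⟨IsContinuousSection.smul (φ := fun k : K => k.1.val) hf c, C, hC, ?_⟩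
    intro x hx
    simp [hf' x hx]

variable {p K}

/-- The product `B(k) × B(l) → B(m)` for `k`, `l`, `m` in `K` with `k l = m`. -/
def kmul {k l m : K} (h : k * l = m) (a : Fibre p k.1.val) (b : Fibre p l.1.val) :
    Fibre p m.1.val :=
  fmul (k.1.src_val.trans l.1.rng_val.symm) (by rw [← h]; rfl) a b

/-- The involution `B(k) → B(m)` for `m = k⁻¹` in `K`. -/
def kstar {k m : K} (h : k⁻¹ = m) (a : Fibre p k.1.val) : Fibre p m.1.val :=
  fstar (by rw [← h]; rfl) a

/-- `h` is the convolution `f * g`, that is `h(s) = ∫ f(r) g(r⁻¹ s) dμ(r)`. (This formula defines a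
continuous compactly supported section for all `f` and `g` in `Γ_c(K, E)`.) -/
def IsConvolution (μ : Measure K) (f g h : sectionsC p K) : Prop :=
  ∀ s : K, h.1 s = ∫ r : K, kmul (mul_inv_cancel_left r s) (f.1 r) (g.1 (r⁻¹ * s)) ∂μ

/-- `g` is the adjoint `f*`, that is `g(s) = f(s⁻¹)*` (the groupoid convention, without modular
function). -/
def IsAdjointSection (f g : sectionsC p K) : Prop :=
  ∀ s : K, g.1 s = kstar (inv_inv s) (f.1 s⁻¹)

/-- The `I`-norm on `Γ_c(K, E)`. -/
def iNorm (μ : Measure K) (f : sectionsC p K) : ℝ :=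
  max (∫ s, ‖f.1 s‖ ∂μ) (∫ s, ‖f.1 s⁻¹‖ ∂μ)

variable (p K) in
/-- An `I`-norm decreasing `*`-representation of the convolution algebra `Γ_c(K, E)` on a Hilbert
space. -/
structure INormRep (μ : Measure K) where
  space : Type (max u v)
  [group : NormedAddCommGroup space]
  [inner : InnerProductSpace ℂ space]
  [complete : CompleteSpace space]
  toFun : sectionsC p K →ₗ[ℂ] (space →L[ℂ] space)
  map_convolution : ∀ f g h, IsConvolution μ f g h → toFun h = toFun f * toFun g
  map_adjoint : ∀ f g, IsAdjointSection f g → toFun g = star (toFun f)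
  norm_le : ∀ f, ‖toFun f‖ ≤ iNorm μ f

attribute [instance] INormRep.group INormRep.inner
attribute [instance] INormRep.complete

/-- The direct sum of all `I`-norm decreasing representations of `Γ_c(K, E)`. -/
def universalRep (μ : Measure K) (f : sectionsC p K) :
    lp (fun R : INormRep p K μ => R.space →L[ℂ] R.space) ∞ :=
  ⟨fun R => R.toFun f, memℓp_infty ⟨iNorm μ f, by
    rintro _ ⟨R, rfl⟩
    exact R.norm_le f⟩⟩

variable (p K) in
/-- The `C*`-algebra `C*(K, E)` of the restriction of the Fell bundle to `K`: the completion of the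
`*`-algebra `Γ_c(K, E)` in the universal norm `‖f‖ = sup_R ‖R(f)‖`, where `R` runs over the `I`-norm
decreasing representations. It is realized as the closed `*`-subalgebra generated by (hence the
closure of) the range of the direct sum of these representations. -/
def fellCStar (μ : Measure K) :
    NonUnitalStarSubalgebra ℂ (lp (fun R : INormRep p K μ => R.space →L[ℂ] R.space) ∞) :=
  (NonUnitalStarAlgebra.adjoin ℂ (Set.range (universalRep (p := p) (K := K) μ))).topologicalClosure

/-- The canonical map `Γ_c(K, E) → C*(K, E)`. -/
def toFellCStar (μ : Measure K) (f : sectionsC p K) : fellCStar p K μ :=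
  ⟨universalRep μ f, subset_closure (NonUnitalStarAlgebra.subset_adjoin ℂ _ ⟨f, rfl⟩)⟩

variable (p K) in
/-- A strongly continuous `*`-homomorphism `π : E|_K → B(H)`. -/
structure FellRep (H : Type*) [NormedAddCommGroup H] [InnerProductSpace ℂ H]
    [CompleteSpace H] where
  toFun : ∀ k : K, Fibre p k.1.val →ₗ[ℂ] (H →L[ℂ] H)
  map_mul : ∀ (k l : K) (a : Fibre p k.1.val) (b : Fibre p l.1.val),
    toFun (k * l) (kmul rfl a b) = toFun k a * toFun l b
  map_star : ∀ (k : K) (a : Fibre p k.1.val), toFun k⁻¹ (kstar rfl a) = star (toFun k a)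
  strongly_continuous : ∀ ξ : H, Continuous fun z : {z : K × E // p z.2 = z.1.1.val} =>
    toFun z.1.1 ⟨z.1.2, z.2⟩ ξ

variable {H : Type*} [NormedAddCommGroup H] [InnerProductSpace ℂ H] [CompleteSpace H]

theorem FellRep.congr (π : FellRep p K H) {k l : K} (h : k = l) {a : Fibre p k.1.val}
    {b : Fibre p l.1.val} (hab : a.val = b.val) : π.toFun k a = π.toFun l b := by
  subst h
  rw [Fibre.ext hab]

/-- The restriction `π|_{A(u)}` of `π` to the fibre `A(u) = B(u)` over the identity of `K`. -/
def FellRep.restrictUnit (π : FellRep p K H) : Fibre p u.1 →⋆ₙₐ[ℂ] (H →L[ℂ] H) where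
  toFun a := π.toFun 1 a
  map_smul' c a := (π.toFun 1).map_smul c a
  map_zero' := (π.toFun 1).map_zero
  map_add' a b := (π.toFun 1).map_add a b
  map_mul' a b := (π.congr (mul_one (1 : K)).symm rfl).trans (π.map_mul 1 1 a b)
  map_star' a := (π.congr (inv_one (G := K)).symm rfl).trans (π.map_star 1 a)

/-- The modular function of `K`, normalized by `∫ f(r) dμ(r) = Δ(s) ∫ f(r s) dμ(r)` for a left Haar
measure `μ`. -/
def modularFn (μ : Measure K) [μ.IsHaarMeasure] (s : K) : ℝ :=
  ((Measure.haarScalarFactor (μ.map (· * s)) μ)⁻¹ : ℝ≥0)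

/-- `L` is the integrated form of `π`: `L(f) ξ = ∫ π(f(s)) ξ Δ(s)^(-1/2) dμ(s)` for all `f` in
`Γ_c(K, E)`. -/
def IsIntegratedForm (μ : Measure K) [μ.IsHaarMeasure] (L : fellCStar p K μ →⋆ₙₐ[ℂ] (H →L[ℂ] H))
    (π : FellRep p K H) : Prop :=
  ∀ (f : sectionsC p K) (ξ : H),
    L (toFellCStar μ f) ξ = ∫ s : K, (modularFn μ s ^ (-(1 / 2) : ℝ)) • π.toFun s (f.1 s) ξ ∂μ

end GroupBundle

end

/-!
Write `A(u)` for the fibre over `u = x₀`, `N` for `P` regarded as an ideal of `A(u)`, so that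
`N = ker π|_{A(u)}`, and `B(x)` for the fibre over `x` in the stability group.

*An element that detects `N`.* Since primitive ideals are prime, local closedness of `P` gives
`c ∉ P` that lies in every primitive ideal properly containing `P`
(`Prim.exists_notMem_of_isLocallyClosed`). Evaluation `A → A(u)` is surjective
(`evalAt_surjective`), because an upper semicontinuous Banach bundle over a paracompact Hausdorff
space has enough continuous sections (`USCBanachBundle.exists_continuous_section`). Irreducible
representations separate elements from kernels of representations (`exists_isIrreducibleRep`, by
the Krein–Milman theorem and the GNS construction). So the value `d = c(u)` is not in `N` but is
annihilated by every representation of `A(u)` whose kernel properly contains `N`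
(`exists_notMem_idealAt`).

*An invariant subspace.* Let `K₀ = {ξ | π(d) π(a) ξ = 0 for all a ∈ A(u)}`. For `ξ ∈ K₀` and `x` in
the stability group consider the subrepresentation of `π|_{A(u)}` generated by `π(B(x)) ξ`. It
annihilates `c' d c*` for all `c`, `c'` in `B(x)`, as
`π(c' d c*) π(b) ξ = π(c') π(d) π(c* b) ξ = 0`. Not all of these are in `N`: otherwise `d ∈ N` by fullness of `B(x)` and invariance of `N` under the
stability group (`mem_of_forall_conj_mem`). So the kernel is larger than `N` and `π(d)` annihilates
`π(B(x)) ξ`, that is, `π(B(x)) ξ ⊆ K₀` (`FellRep.toFun_mem_nullSubspace`). Hence `K₀` is invariant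
under `π`; it therefore reduces the integrated form `L`, and by irreducibility it is `0` or all of
the space (`FellRep.eq_bot_or_eq_top_of_invariant`). It is not everything, because `d ∉ N`.

If now `e ≠ 0` is a projection in the commutant of `π(A(u))` and the kernel of the
subrepresentation on the range of `e` is larger than `N`, then `π(d) e = 0`, so the range of `e` is
contained in `K₀ = 0`, a contradiction. Nondegeneracy follows in the same way from the invariance
of the subspace annihilated by `A(u)`.
-/

/-! ### Closed subspaces reducing a set of operators -/

section Reducing

variable {H : Type*} [NormedAddCommGroup H] [InnerProductSpace ℂ H]

open scoped InnerProductSpace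

theorem commute_starProjection_of_orthogonal {M : Submodule ℂ H} [M.HasOrthogonalProjection]
    {T : H →L[ℂ] H} (h : ∀ ξ ∈ M, T ξ ∈ M) (h' : ∀ ξ ∈ Mᗮ, T ξ ∈ Mᗮ) :
    Commute M.starProjection T := by
  refine ContinuousLinearMap.ext fun ξ => ?_
  change M.starProjection (T ξ) = T (M.starProjection ξ)
  refine Submodule.eq_starProjection_of_mem_orthogonal (h _ (M.starProjection_apply_mem ξ)) ?_
  rw [← map_sub]
  exact h' _ (M.sub_starProjection_mem_orthogonal ξ)

theorem mem_orthogonal_of_star [CompleteSpace H] {M : Submodule ℂ H} {T : H →L[ℂ] H}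
    (h : ∀ ξ ∈ M, star T ξ ∈ M) : ∀ ξ ∈ Mᗮ, T ξ ∈ Mᗮ := by
  intro ξ hξ
  rw [Submodule.mem_orthogonal]
  intro m hm
  rw [← ContinuousLinearMap.adjoint_inner_left]
  exact Submodule.inner_right_of_mem_orthogonal (h m hm) hξ

theorem mem_of_commute_starProjection {M : Submodule ℂ H} [M.HasOrthogonalProjection]
    {T : H →L[ℂ] H} (h : Commute M.starProjection T) {ξ : H} (hξ : ξ ∈ M) : T ξ ∈ M := by
  have h1 : M.starProjection (T ξ) = T (M.starProjection ξ) := DFunLike.congr_fun h.eq ξ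
  rw [Submodule.starProjection_eq_self_iff.2 hξ] at h1
  exact Submodule.starProjection_eq_self_iff.1 h1

theorem commute_starProjection_of_invariant [CompleteSpace H] {R : Type*} [NonUnitalRing R]
    [Module ℂ R] [StarRing R]
    (ρ : R →⋆ₙₐ[ℂ] (H →L[ℂ] H)) {M : Submodule ℂ H} [M.HasOrthogonalProjection]
    (h : ∀ a, ∀ ξ ∈ M, ρ a ξ ∈ M) (a : R) : Commute M.starProjection (ρ a) :=
  commute_starProjection_of_orthogonal (h a)
    (mem_orthogonal_of_star (by rw [← map_star]; exact h (star a)))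

theorem commute_star_starProjection [CompleteSpace H] {M : Submodule ℂ H}
    [M.HasOrthogonalProjection] {T : H →L[ℂ] H} (h : Commute M.starProjection T) :
    Commute M.starProjection (star T) := by
  have := h.star_star
  rwa [(isStarProjection_starProjection (U := M)).isSelfAdjoint.star_eq] at this

end Reducing

/-! ### Irreducible representations -/

section Irreducible

variable {R : Type*} [NonUnitalRing R] [Module ℂ R] [StarRing R]
variable {H : Type*} [NormedAddCommGroup H] [InnerProductSpace ℂ H]

theorem isClosed_setOf_forall_eq_zero {ι : Type*} (T : ι → H →L[ℂ] H) :
    IsClosed {ξ | ∀ i, T i ξ = 0} := by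
  simp only [Set.ofPred_forall]
  exact isClosed_iInter fun i => isClosed_eq (T i).continuous continuous_const

/-- The vectors annihilated by a family of operators. -/
noncomputable def nullSubspace {ι : Type*} (T : ι → H →L[ℂ] H) : Submodule ℂ H where
  carrier := {ξ | ∀ i, T i ξ = 0}
  add_mem' h h' i := by rw [map_add, h i, h' i, add_zero]
  zero_mem' i := map_zero _
  smul_mem' c ξ h i := by rw [map_smul, h i, smul_zero]

variable [CompleteSpace H]

theorem IsIrreducibleRep.eq_zero_of_forall {ρ : R →⋆ₙₐ[ℂ] (H →L[ℂ] H)} (hρ : IsIrreducibleRep ρ)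
    {ξ : H} (h : ∀ a, ρ a ξ = 0) : ξ = 0 := by
  rcases hρ.2 (nullSubspace fun a => ρ a) (isClosed_setOf_forall_eq_zero _)
    (fun a η hη b => by rw [hη a, map_zero]) with h1 | h1
  · have : ξ ∈ nullSubspace fun a => ρ a := h
    rwa [h1, Submodule.mem_bot] at this
  · obtain ⟨a, ha⟩ := hρ.1
    refine absurd (ContinuousLinearMap.ext fun η => ?_) ha
    have : η ∈ nullSubspace fun a => ρ a := by rw [h1]; trivial
    exact this a

/-- Every nonzero vector is cyclic for an irreducible representation. -/
theorem IsIrreducibleRep.closure_orbit {ρ : R →⋆ₙₐ[ℂ] (H →L[ℂ] H)} (hρ : IsIrreducibleRep ρ)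
    {ξ : H} (hξ : ξ ≠ 0) : closure (Set.range fun a => ρ a ξ) = Set.univ := by
  let N : Submodule ℂ H :=
    { carrier := Set.range fun a => ρ a ξ
      add_mem' := by rintro _ _ ⟨a, rfl⟩ ⟨b, rfl⟩; exact ⟨a + b, by simp⟩
      zero_mem' := ⟨0, by simp⟩
      smul_mem' := by rintro c _ ⟨a, rfl⟩; exact ⟨c • a, by simp⟩ }
  have hinv : ∀ a, ∀ η ∈ N.topologicalClosure, ρ a η ∈ N.topologicalClosure := by
    intro a η hη
    refine map_mem_closure (ρ a).continuous hη ?_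
    rintro _ ⟨b, rfl⟩
    exact ⟨a * b, by simp⟩
  rcases hρ.2 _ N.isClosed_topologicalClosure hinv with h | h
  · refine absurd (hρ.eq_zero_of_forall fun a => ?_) hξ
    have : ρ a ξ ∈ N.topologicalClosure := N.le_topologicalClosure ⟨a, rfl⟩
    rwa [h, Submodule.mem_bot] at this
  · have := congrArg (fun S : Submodule ℂ H => (S : Set H)) h
    exact this

/-- The kernel of an irreducible representation is a prime ideal. -/
theorem IsIrreducibleRep.exists_mul_mul_ne_zero {ρ : R →⋆ₙₐ[ℂ] (H →L[ℂ] H)}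
    (hρ : IsIrreducibleRep ρ) {a b : R} (ha : ρ a ≠ 0) (hb : ρ b ≠ 0) :
    ∃ c, ρ (a * c * b) ≠ 0 := by
  by_contra! h
  obtain ⟨ξ, hξ⟩ : ∃ ξ, ρ b ξ ≠ 0 := by
    by_contra! h'
    exact hb (ContinuousLinearMap.ext h')
  refine ha (ContinuousLinearMap.ext fun η => ?_)
  have hη : η ∈ closure (Set.range fun c => ρ c (ρ b ξ)) := by
    rw [hρ.closure_orbit hξ]; trivial
  refine closure_minimal (t := {η | ρ a η = 0}) ?_
    (isClosed_eq (ρ a).continuous continuous_const) hη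
  rintro _ ⟨c, rfl⟩
  have := DFunLike.congr_fun (h c) ξ
  simpa using this

theorem IsIrreducibleRep.conj {K : Type*} [NormedAddCommGroup K] [InnerProductSpace ℂ K]
    [CompleteSpace K] {ρ : R →⋆ₙₐ[ℂ] (H →L[ℂ] H)} (hρ : IsIrreducibleRep ρ) (e : H ≃ₗᵢ[ℂ] K)
    {ρ' : R →⋆ₙₐ[ℂ] (K →L[ℂ] K)} (h : ∀ a ξ, ρ' a ξ = e (ρ a (e.symm ξ))) :
    IsIrreducibleRep ρ' := by
  refine ⟨?_, fun M hM hinv => ?_⟩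
  · obtain ⟨a, ha⟩ := hρ.1
    refine ⟨a, fun h0 => ha (ContinuousLinearMap.ext fun ξ => ?_)⟩
    have := h a (e ξ)
    rw [h0] at this
    simpa using this.symm
  · have key := hρ.2 (M.comap (e.toLinearEquiv : H →ₗ[ℂ] K)) (hM.preimage e.continuous)
      (fun a ξ hξ => by
        have := hinv a _ hξ
        rw [h] at this
        simpa using this)
    rcases key with h1 | h1
    · left
      rw [Submodule.eq_bot_iff]
      intro x hx
      have h2 : e.symm x ∈ M.comap (e.toLinearEquiv : H →ₗ[ℂ] K) := by simpa using hx
      rw [h1, Submodule.mem_bot] at h2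
      simpa using h2
    · right
      rw [Submodule.eq_top_iff']
      intro x
      have h2 : e.symm x ∈ M.comap (e.toLinearEquiv : H →ₗ[ℂ] K) := by rw [h1]; trivial
      simpa using h2

/-- A Hilbert space whose underlying type is small is isometric to one in the smaller universe,
namely to `ℓ²` of a small copy of a Hilbert basis. -/
theorem exists_linearIsometryEquiv_of_small (H : Type*) [NormedAddCommGroup H]
    [InnerProductSpace ℂ H] [CompleteSpace H] [Small.{w} H] :
    ∃ (K : Type w) (_ : NormedAddCommGroup K) (_ : InnerProductSpace ℂ K) (_ : CompleteSpace K),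
      Nonempty (H ≃ₗᵢ[ℂ] K) := by
  obtain ⟨s, b, hb⟩ := exists_hilbertBasis ℂ H
  let v : Shrink.{w} s → H := fun i => b ((equivShrink s).symm i)
  have hv : Orthonormal ℂ v := b.orthonormal.comp _ (equivShrink s).symm.injective
  have hr : Set.range v = Set.range b := (equivShrink s).symm.surjective.range_comp b
  let b' : HilbertBasis (Shrink.{w} s) ℂ H := HilbertBasis.mk hv (by rw [hr, b.dense_span])
  exact ⟨_, _, _, inferInstance, ⟨b'.repr⟩⟩

/-- Each point is the limit of a sequence in the dense range, and is determined by it. -/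
theorem small_of_dense_range {X : Type*} [MetricSpace X] {Y : Type w} {g : Y → X}
    (hg : DenseRange g) : Small.{w} X := by
  have hs : ∀ x : X, ∃ s : ℕ → Y, Tendsto (g ∘ s) atTop (𝓝 x) := by
    intro x
    obtain ⟨t, ht, htx⟩ := mem_closure_iff_seq_limit.1 (hg x)
    choose s hs using ht
    exact ⟨s, by rwa [show g ∘ s = t from funext hs]⟩
  choose s hs using hs
  refine small_of_injective (f := s) fun x y hxy => ?_
  have := hs y
  rw [← hxy] at this
  exact tendsto_nhds_unique (hs x) this

end Irreducible

/-! ### Pure states -/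

section PureStates

variable (D : Type*) [CStarAlgebra D]

open scoped ComplexOrder InnerProductSpace

/-- The states of a unital `C*`-algebra, as a subset of the product space `D → ℂ`. -/
def stateSet : Set (D → ℂ) :=
  {φ | (∀ x y, φ (x + y) = φ x + φ y) ∧ (∀ (c : ℂ) x, φ (c • x) = c * φ x) ∧ φ 1 = 1 ∧
    (∀ x, 0 ≤ φ (star x * x)) ∧ ∀ x, ‖φ x‖ ≤ ‖x‖}

theorem isCompact_stateSet : IsCompact (stateSet D) := by
  refine (isCompact_univ_pi fun x : D => isCompact_closedBall (0 : ℂ) ‖x‖).of_isClosed_subset ?_ ?_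
  · simp only [stateSet, Set.ofPred_and, Set.ofPred_forall]
    refine IsClosed.inter ?_ (IsClosed.inter ?_ (IsClosed.inter ?_ (IsClosed.inter ?_ ?_)))
    · exact isClosed_iInter fun x => isClosed_iInter fun y =>
        isClosed_eq (by fun_prop) (by fun_prop)
    · exact isClosed_iInter fun x => isClosed_iInter fun y =>
        isClosed_eq (by fun_prop) (by fun_prop)
    · exact isClosed_eq (by fun_prop) (by fun_prop)
    · exact isClosed_iInter fun x => isClosed_le (by fun_prop) (by fun_prop)
    · exact isClosed_iInter fun x => isClosed_le (by fun_prop) (by fun_prop)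
  · intro φ hφ x _
    simpa using hφ.2.2.2.2 x

variable {D}

theorem vectorState_mem_stateSet {K : Type*} [NormedAddCommGroup K] [InnerProductSpace ℂ K]
    [CompleteSpace K] (σ : D →⋆ₐ[ℂ] (K →L[ℂ] K)) {ξ : K} (hξ : ‖ξ‖ = 1) :
    (fun x => ⟪ξ, σ x ξ⟫_ℂ) ∈ stateSet D := by
  refine ⟨fun x y => by simp, fun c x => by simp, ?_, ?_, ?_⟩
  · simp [inner_self_eq_norm_sq_to_K, hξ]
  · intro x
    change 0 ≤ ⟪ξ, σ (star x * x) ξ⟫_ℂ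
    rw [map_mul, map_star]
    change 0 ≤ ⟪ξ, ContinuousLinearMap.adjoint (σ x) (σ x ξ)⟫_ℂ
    rw [ContinuousLinearMap.adjoint_inner_right, inner_self_eq_norm_sq_to_K]
    rw [← RCLike.ofReal_pow]
    exact Complex.zero_le_real.2 (sq_nonneg _)
  · intro x
    refine (norm_inner_le_norm _ _).trans ?_
    rw [hξ, one_mul]
    refine ((σ x).le_opNorm ξ).trans ?_
    rw [hξ, mul_one]
    exact NonUnitalStarAlgHom.norm_apply_le σ x

/-- The Gelfand–Naimark–Segal construction with its cyclic unit vector. -/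
theorem exists_gns {D : Type u} [CStarAlgebra D] {φ : D → ℂ} (hφ : φ ∈ stateSet D) :
    ∃ (K : Type u) (_ : NormedAddCommGroup K) (_ : InnerProductSpace ℂ K) (_ : CompleteSpace K)
      (σ : D →⋆ₐ[ℂ] (K →L[ℂ] K)) (Ω : K), ‖Ω‖ = 1 ∧ DenseRange (fun x => σ x Ω) ∧
      ∀ x, φ x = ⟪Ω, σ x Ω⟫_ℂ := by
  let _ := CStarAlgebra.spectralOrder D
  let _ := CStarAlgebra.spectralOrderedRing D
  obtain ⟨hadd, hsmul, hone, hpos, -⟩ := hφ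
  let f : D →ₚ[ℂ] ℂ := PositiveLinearMap.mk₀
    { toFun := φ, map_add' := hadd, map_smul' := hsmul } (fun x hx => by
      obtain ⟨y, rfl⟩ := CStarAlgebra.nonneg_iff_eq_star_mul_self.1 hx
      exact hpos y)
  have hf : ∀ x, f x = φ x := fun x => rfl
  have hΩ : ∀ x, f.gnsStarAlgHom x ((f.toPreGNS 1 : f.PreGNS) : f.GNS) =
      ((f.toPreGNS x : f.PreGNS) : f.GNS) := by
    intro x
    simp
  refine ⟨f.GNS, inferInstance, inferInstance, inferInstance, f.gnsStarAlgHom,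
    ((f.toPreGNS 1 : f.PreGNS) : f.GNS), ?_, ?_, ?_⟩
  · rw [UniformSpace.Completion.norm_coe, PositiveLinearMap.preGNS_norm_def]
    simp [hf, hone]
  · simp only [hΩ]
    exact UniformSpace.Completion.denseRange_coe.comp f.toPreGNS.surjective.denseRange
      (UniformSpace.Completion.continuous_coe _)
  · intro x
    rw [hΩ, UniformSpace.Completion.inner_coe, PositiveLinearMap.preGNS_inner_def]
    simp [hf]

/-- The Gelfand–Naimark–Segal representation of an extreme state is irreducible. -/
theorem isIrreducibleRep_of_mem_extremePoints {K : Type*} [NormedAddCommGroup K]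
    [InnerProductSpace ℂ K] [CompleteSpace K] (σ : D →⋆ₐ[ℂ] (K →L[ℂ] K)) {Ω : K} (hΩ : ‖Ω‖ = 1)
    (hcyc : DenseRange fun x => σ x Ω)
    (hext : (fun x => ⟪Ω, σ x Ω⟫_ℂ) ∈ (stateSet D).extremePoints ℝ) :
    IsIrreducibleRep (σ : D →⋆ₙₐ[ℂ] (K →L[ℂ] K)) := by
  have hΩ0 : Ω ≠ 0 := by rintro rfl; simp at hΩ
  refine ⟨⟨1, fun h => hΩ0 ?_⟩, fun M hM hinv => ?_⟩
  · have := DFunLike.congr_fun h Ω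
    simpa using this
  have : CompleteSpace M := hM.completeSpace_coe
  set P := M.starProjection with hP
  have hcomm : ∀ x, Commute P (σ x) := fun x =>
    commute_starProjection_of_invariant (σ : D →⋆ₙₐ[ℂ] (K →L[ℂ] K)) hinv x
  have hcomm' : ∀ x ξ, P (σ x ξ) = σ x (P ξ) := fun x ξ => DFunLike.congr_fun (hcomm x).eq ξ
  have hPP : ∀ ξ, P (P ξ) = P ξ := fun ξ =>
    Submodule.starProjection_eq_self_iff.2 (M.starProjection_apply_mem ξ)
  -- an operator in the commutant is determined by its value at the cyclic vector
  have hdet : ∀ c : ℂ, P Ω = c • Ω → ∀ ξ, P ξ = c • ξ := by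
    intro c hc
    refine fun ξ => congrFun (hcyc.equalizer P.continuous (continuous_const_smul c) ?_) ξ
    funext x
    simp [hcomm', hc]
  by_cases h0 : P Ω = 0
  · left
    rw [Submodule.eq_bot_iff]
    intro ξ hξ
    rw [← Submodule.starProjection_eq_self_iff.2 hξ, ← hP, hdet 0 (by simp [h0]) ξ, zero_smul]
  by_cases h1 : P Ω = Ω
  · right
    rw [Submodule.eq_top_iff']
    intro ξ
    rw [← Submodule.starProjection_eq_self_iff, ← hP, hdet 1 (by simp [h1]) ξ, one_smul]
  exfalso
  set ξ := P Ω with hξ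
  set η := Ω - P Ω with hη
  have hη0 : η ≠ 0 := fun h => h1 (sub_eq_zero.1 h).symm
  have hinner : ∀ x, ⟪ξ, σ x η⟫_ℂ = 0 := by
    intro x
    have : ⟪P Ω, σ x η⟫_ℂ = ⟪Ω, P (σ x η)⟫_ℂ := M.inner_starProjection_left_eq_right _ _
    rw [hξ, this, hcomm', hη, map_sub, hPP, sub_self, map_zero, inner_zero_right]
  have hinner' : ∀ x, ⟪η, σ x ξ⟫_ℂ = 0 := by
    intro x
    have h2 : ⟪η, P (σ x Ω)⟫_ℂ = ⟪P η, σ x Ω⟫_ℂ := (M.inner_starProjection_left_eq_right _ _).symm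
    rw [hξ, ← hcomm', h2, hη, map_sub, hPP, sub_self, inner_zero_left]
  have hsum : Ω = ξ + η := by rw [hη]; abel
  have hdecomp : ∀ x, ⟪Ω, σ x Ω⟫_ℂ = ⟪ξ, σ x ξ⟫_ℂ + ⟪η, σ x η⟫_ℂ := by
    intro x
    conv_lhs => rw [hsum]
    simp only [map_add, inner_add_left, inner_add_right, hinner, hinner']
    ring
  have hnorm : ‖ξ‖ ^ 2 + ‖η‖ ^ 2 = 1 := by
    have := hdecomp 1
    simp only [map_one, one_apply_eq_self, inner_self_eq_norm_sq_to_K, hΩ] at this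
    refine Complex.ofReal_injective ?_
    push_cast
    simpa using this.symm
  have hξn : 0 < ‖ξ‖ := norm_pos_iff.2 h0
  have hηn : 0 < ‖η‖ := norm_pos_iff.2 hη0
  -- the normalized vector states of `P Ω` and `(1 - P) Ω` decompose the given state
  have hstate : ∀ {ζ : K}, 0 < ‖ζ‖ →
      (fun x => ⟪(‖ζ‖⁻¹ : ℂ) • ζ, σ x ((‖ζ‖⁻¹ : ℂ) • ζ)⟫_ℂ) ∈ stateSet D := by
    intro ζ hζ
    refine vectorState_mem_stateSet σ ?_
    rw [norm_smul, norm_inv, Complex.norm_real, norm_norm, inv_mul_cancel₀ hζ.ne']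
  have hval : ∀ {ζ : K}, 0 < ‖ζ‖ → ∀ x, ((‖ζ‖ ^ 2 : ℝ) : ℂ) *
      ⟪(‖ζ‖⁻¹ : ℂ) • ζ, σ x ((‖ζ‖⁻¹ : ℂ) • ζ)⟫_ℂ = ⟪ζ, σ x ζ⟫_ℂ := by
    intro ζ hζ x
    have : (‖ζ‖ : ℂ) ≠ 0 := by exact_mod_cast hζ.ne'
    simp only [map_smul, inner_smul_left, inner_smul_right, map_inv₀, Complex.conj_ofReal]
    push_cast
    field_simp
  have heq := hext.2 (hstate hξn) (hstate hηn)
    ⟨‖ξ‖ ^ 2, ‖η‖ ^ 2, by positivity, by positivity, hnorm, by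
      funext x
      simp only [Pi.add_apply, Pi.smul_apply, Complex.real_smul]
      rw [hval hξn, hval hηn, hdecomp]⟩
  have hprop : ∀ x, ⟪Ω, σ x ξ⟫_ℂ = ((‖ξ‖ ^ 2 : ℝ) : ℂ) * ⟪Ω, σ x Ω⟫_ℂ := by
    intro x
    have h2 := hval hξn x
    rw [show ⟪(‖ξ‖⁻¹ : ℂ) • ξ, σ x ((‖ξ‖⁻¹ : ℂ) • ξ)⟫_ℂ = ⟪Ω, σ x Ω⟫_ℂ from congrFun heq x] at h2
    rw [h2]
    conv_lhs => rw [hsum]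
    rw [inner_add_left, hinner', add_zero]
  have hPΩ : ξ = ((‖ξ‖ ^ 2 : ℝ) : ℂ) • Ω := by
    rw [← sub_eq_zero]
    refine hcyc.eq_zero_of_inner_right ℂ ?_
    intro x
    have h3 : ∀ ζ, ⟪σ x Ω, ζ⟫_ℂ = ⟪Ω, σ (star x) ζ⟫_ℂ := by
      intro ζ
      rw [map_star]
      exact (ContinuousLinearMap.adjoint_inner_right (σ x) Ω ζ).symm
    change ⟪σ x Ω, _⟫_ℂ = 0
    rw [inner_sub_right, h3, inner_smul_right, h3, hprop, sub_self]
  have h4 := hinner' 1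
  rw [map_one, hPΩ] at h4
  have h5 : ⟪η, Ω⟫_ℂ = 0 := by
    have h6 : ((‖ξ‖ ^ 2 : ℝ) : ℂ) ≠ 0 := by exact_mod_cast (by positivity : ‖ξ‖ ^ 2 ≠ 0)
    simpa [inner_smul_right, h0] using h4
  have h8 : ⟪η, η⟫_ℂ = 0 := by
    have := hinner' 1
    rw [map_one] at this
    conv_lhs => arg 2; rw [hη]
    rw [inner_sub_right, h5, ← hξ]
    simpa using this
  exact hη0 (inner_self_eq_zero.1 h8)

/-- If some state is nonzero at `y* y`, then some irreducible representation is nonzero at `y`: an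
extreme point of the face of states that are maximal at `y* y` provides one. -/
theorem exists_isIrreducibleRep_of_state {D : Type u} [CStarAlgebra D] {φ : D → ℂ}
    (hφ : φ ∈ stateSet D) {y : D} (hy : φ (star y * y) ≠ 0) :
    ∃ (K : Type u) (_ : NormedAddCommGroup K) (_ : InnerProductSpace ℂ K) (_ : CompleteSpace K)
      (σ : D →⋆ₐ[ℂ] (K →L[ℂ] K)), IsIrreducibleRep (σ : D →⋆ₙₐ[ℂ] (K →L[ℂ] K)) ∧ σ y ≠ 0 := by
  let l : StrongDual ℝ (D → ℂ) :=
    Complex.reCLM.comp (ContinuousLinearMap.proj (R := ℝ) (φ := fun _ : D => ℂ) (star y * y))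
  have hl : ∀ ψ : D → ℂ, l ψ = (ψ (star y * y)).re := fun ψ => rfl
  have hexp : IsExposed ℝ (stateSet D) (l.toExposed (stateSet D)) :=
    ContinuousLinearMap.toExposed.isExposed
  have hne : (l.toExposed (stateSet D)).Nonempty := by
    obtain ⟨ψ, hψ, hmax⟩ := (isCompact_stateSet D).exists_isMaxOn ⟨φ, hφ⟩ l.continuous.continuousOn
    exact ⟨ψ, hψ, fun χ hχ => hmax hχ⟩
  obtain ⟨ψ, hψ⟩ := (hexp.isCompact (isCompact_stateSet D)).extremePoints_nonempty hne
  have hψS := hexp.isExtreme.extremePoints_subset_extremePoints hψ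
  have hpos : 0 < (ψ (star y * y)).re := by
    refine lt_of_lt_of_le ?_ (hψ.1.2 φ hφ)
    rw [hl]
    have h1 := hφ.2.2.2.1 y
    rw [Complex.le_def] at h1
    refine lt_of_le_of_ne h1.1 fun h => hy ?_
    exact Complex.ext h.symm h1.2.symm
  obtain ⟨K, _, _, _, σ, Ω, hΩ, hcyc, hval⟩ := exists_gns hψS.1
  refine ⟨K, _, _, _, σ, isIrreducibleRep_of_mem_extremePoints σ hΩ hcyc ?_, fun h => ?_⟩
  · rwa [show (fun x => ⟪Ω, σ x Ω⟫_ℂ) = ψ from funext fun x => (hval x).symm]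
  · rw [hval, map_mul, h] at hpos
    simp at hpos

end PureStates

/-! ### Separation by irreducible representations -/

section Separation

variable {R : Type v} [NonUnitalCStarAlgebra R]
variable {H : Type*} [NormedAddCommGroup H] [InnerProductSpace ℂ H] [CompleteSpace H]

open scoped InnerProductSpace

/-- A representation of `R` factors through a faithfully represented unital `C*`-algebra in which
its range generates a dense subalgebra. -/
theorem exists_cstarAlgebra_factorization {H : Type w} [NormedAddCommGroup H]
    [InnerProductSpace ℂ H] [CompleteSpace H] (θ : R →⋆ₙₐ[ℂ] (H →L[ℂ] H)) :
    ∃ (D : Type w) (_ : CStarAlgebra D) (ι : D →⋆ₐ[ℂ] (H →L[ℂ] H)) (θ' : R →⋆ₙₐ[ℂ] D),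
      Function.Injective ι ∧ (∀ a, ι (θ' a) = θ a) ∧
      Dense (StarAlgebra.adjoin ℂ (Set.range θ') : Set D) := by
  let D : StarSubalgebra ℂ (H →L[ℂ] H) :=
    (StarAlgebra.adjoin ℂ (Set.range θ)).topologicalClosure
  have hD : IsClosed (D : Set (H →L[ℂ] H)) := StarSubalgebra.isClosed_topologicalClosure _
  have hle : ∀ x ∈ StarAlgebra.adjoin ℂ (Set.range θ), x ∈ D :=
    StarSubalgebra.le_topologicalClosure _
  have hθ : ∀ a, θ a ∈ D := fun a => hle _ (StarAlgebra.subset_adjoin ℂ _ ⟨a, rfl⟩)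
  let θ' : R →⋆ₙₐ[ℂ] D :=
    { toFun := fun a => ⟨θ a, hθ a⟩
      map_smul' := fun c a => Subtype.ext (map_smul θ c a)
      map_zero' := Subtype.ext (map_zero θ)
      map_add' := fun a b => Subtype.ext (map_add θ a b)
      map_mul' := fun a b => Subtype.ext (map_mul θ a b)
      map_star' := fun a => Subtype.ext (map_star θ a) }
  have hadj : (StarAlgebra.adjoin ℂ (Set.range θ')).map D.subtype =
      StarAlgebra.adjoin ℂ (Set.range θ) := by
    rw [StarAlgHom.map_adjoin, ← Set.range_comp]
    rfl
  have hdense : ∀ x : D, x ∈ closure (StarAlgebra.adjoin ℂ (Set.range θ') : Set D) := by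
    intro x
    rw [closure_subtype]
    refine closure_mono ?_ x.2
    rw [← hadj]
    exact subset_rfl
  exact ⟨D, StarSubalgebra.cstarAlgebra D (h_closed := hD), D.subtype, θ',
    Subtype.val_injective, fun a => rfl, hdense⟩

/-- If `θ d ≠ 0`, there is an irreducible representation that is nonzero at `d` and whose kernel
contains that of `θ`. It factors through the unital `C*`-algebra generated by the range of `θ`;
since it has a cyclic vector, its space can be chosen in any universe that contains `R`. -/
theorem exists_isIrreducibleRep {H : Type w} [NormedAddCommGroup H] [InnerProductSpace ℂ H]
    [CompleteSpace H] (θ : R →⋆ₙₐ[ℂ] (H →L[ℂ] H)) {d : R} (hd : θ d ≠ 0) :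
    ∃ (K : Type (max u v)) (_ : NormedAddCommGroup K) (_ : InnerProductSpace ℂ K)
      (_ : CompleteSpace K) (σ : R →⋆ₙₐ[ℂ] (K →L[ℂ] K)), IsIrreducibleRep σ ∧ σ d ≠ 0 ∧
      ∀ a, θ a = 0 → σ a = 0 := by
  obtain ⟨D, _, ι, θ', hι, hιθ, hdense'⟩ := exists_cstarAlgebra_factorization θ
  obtain ⟨ξ, hξ, hdξ⟩ : ∃ ξ : H, ‖ξ‖ = 1 ∧ θ d ξ ≠ 0 := by
    obtain ⟨ξ, hξ⟩ : ∃ ξ, θ d ξ ≠ 0 := by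
      by_contra! h
      exact hd (ContinuousLinearMap.ext h)
    have h0 : ‖ξ‖ ≠ 0 := fun h => hξ (by rw [norm_eq_zero.1 h, map_zero])
    refine ⟨(‖ξ‖⁻¹ : ℂ) • ξ, by simp [norm_smul, h0], ?_⟩
    rw [map_smul]
    exact smul_ne_zero (by simpa using h0) hξ
  obtain ⟨K₀, _, _, _, σ, hσ, hσd⟩ := exists_isIrreducibleRep_of_state
    (vectorState_mem_stateSet ι hξ) (y := θ' d) (by
      rw [map_mul, map_star, hιθ]
      change ⟪ξ, ContinuousLinearMap.adjoint (θ d) (θ d ξ)⟫_ℂ ≠ 0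
      rw [ContinuousLinearMap.adjoint_inner_right]
      simpa using hdξ)
  let τ : R →⋆ₙₐ[ℂ] (K₀ →L[ℂ] K₀) := (σ : D →⋆ₙₐ[ℂ] (K₀ →L[ℂ] K₀)).comp θ'
  have hτ : IsIrreducibleRep τ := by
    refine ⟨⟨d, hσd⟩, fun M hM hinv => hσ.2 M hM fun x => ?_⟩
    have : CompleteSpace M := hM.completeSpace_coe
    suffices h : ∀ x : D, Commute M.starProjection (σ x) from
      fun ξ hξ => mem_of_commute_starProjection (h x) hξ
    have hc : IsClosed {x : D | Commute M.starProjection (σ x)} := by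
      have hcont : Continuous σ := AddMonoidHomClass.continuous_of_bound σ 1 fun x => by
        rw [one_mul]; exact NonUnitalStarAlgHom.norm_apply_le σ x
      exact isClosed_eq (continuous_const.mul hcont) (hcont.mul continuous_const)
    have hadj : ∀ x ∈ StarAlgebra.adjoin ℂ (Set.range θ'), Commute M.starProjection (σ x) := by
      intro x hx
      induction hx using StarAlgebra.adjoin_induction with
      | mem x h =>
        obtain ⟨a, rfl⟩ := h
        exact commute_starProjection_of_invariant τ hinv a
      | algebraMap r =>
        rw [AlgHomClass.commutes σ r]
        exact (Algebra.commutes r M.starProjection).symm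
      | add x y hx hy h1 h2 => rw [map_add]; exact h1.add_right h2
      | mul x y hx hy h1 h2 => rw [map_mul]; exact h1.mul_right h2
      | star x hx h1 => rw [map_star]; exact commute_star_starProjection h1
    exact fun x => closure_minimal hadj hc (hdense' x)
  obtain ⟨ξ, hξ⟩ : ∃ ξ, τ d ξ ≠ 0 := by
    by_contra! h
    exact hσd (ContinuousLinearMap.ext h)
  have hξ0 : ξ ≠ 0 := by rintro rfl; exact hξ (map_zero _)
  have hdense : DenseRange fun a => τ a ξ := by
    rw [DenseRange, dense_iff_closure_eq]
    exact hτ.closure_orbit hξ0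
  have : Small.{v} K₀ := small_of_dense_range hdense
  have : Small.{max u v} K₀ := small_lift.{w, u, v} K₀
  obtain ⟨K, _, _, _, ⟨e⟩⟩ := exists_linearIsometryEquiv_of_small.{max u v} K₀
  refine ⟨K, _, _, _, (e.conjStarAlgEquiv : (K₀ →L[ℂ] K₀) →⋆ₙₐ[ℂ] (K →L[ℂ] K)).comp τ,
    hτ.conj e fun a ξ => rfl, fun h => hσd ?_, fun a ha => ?_⟩
  · exact e.conjStarAlgEquiv.injective (h.trans (map_zero _).symm)
  · have : θ' a = 0 := hι (by rw [hιθ, ha, map_zero])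
    change e.conjStarAlgEquiv (σ (θ' a)) = 0
    rw [this, map_zero, map_zero]

end Separation

/-! ### Continuous sections of upper semicontinuous Banach bundles -/

section Selection

variable {X : Type u} [TopologicalSpace X] {E : Type v} [TopologicalSpace E] {p : E → X}
  [USCBanachBundle p]

namespace USCBanachBundle

theorem norm_inFibre_val {x : X} (a : Fibre p x) : ‖inFibre (p := p) a.val rfl‖ = ‖a‖ := by
  obtain ⟨a, rfl⟩ := a
  rfl

theorem add_val {x : X} (a b : Fibre p x) : (inFibre (p := p) a.val rfl +
    inFibre b.val (b.proj_val.trans a.proj_val.symm)).val = (a + b).val := by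
  obtain ⟨a, rfl⟩ := a
  rfl

theorem smul_val {x : X} (c : ℂ) (a : Fibre p x) :
    (c • inFibre (p := p) a.val rfl).val = (c • a).val := by
  obtain ⟨a, rfl⟩ := a
  rfl

theorem exists_nhds_add {x : X} (a b : Fibre p x) {W : Set E} (hW : W ∈ 𝓝 (a + b).val) :
    ∃ U ∈ 𝓝 a.val, ∃ V ∈ 𝓝 b.val, ∀ (y : X) (a' b' : Fibre p y), a'.val ∈ U → b'.val ∈ V →
      (a' + b').val ∈ W := by
  have hc := (continuous_add (p := p)).continuousAt
    (x := ⟨(a.val, b.val), a.proj_val.trans b.proj_val.symm⟩)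
  rw [← add_val] at hW
  have h := hc.preimage_mem_nhds hW
  obtain ⟨T, hT, hTW⟩ := (mem_nhds_subtype _ _ _).1 h
  obtain ⟨U, hU, V, hV, hUV⟩ := mem_nhds_prod_iff.1 hT
  refine ⟨U, hU, V, hV, fun y a' b' ha' hb' => ?_⟩
  rw [← add_val]
  exact hTW (a := ⟨(a'.val, b'.val), a'.proj_val.trans b'.proj_val.symm⟩) (hUV ⟨ha', hb'⟩)

theorem exists_nhds_smul {x : X} (c : ℂ) (a : Fibre p x) {W : Set E} (hW : W ∈ 𝓝 (c • a).val) :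
    ∃ U ∈ 𝓝 a.val, ∀ (y : X) (a' : Fibre p y), a'.val ∈ U → (c • a').val ∈ W := by
  rw [← smul_val] at hW
  refine ⟨_, (continuous_smul (p := p) c).continuousAt.preimage_mem_nhds hW,
    fun y a' ha' => ?_⟩
  rw [← smul_val]
  exact ha'

theorem exists_nhds_zero {x : X} {V : Set E} (hV : V ∈ 𝓝 (0 : Fibre p x).val) :
    ∃ N ∈ 𝓝 x, ∃ ε > 0, ∀ y ∈ N, ∀ b : Fibre p y, ‖b‖ < ε → b.val ∈ V := by
  have h := le_nhds_zero (p := p) x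
    (comap p (𝓝 x) ⊓ comap (fun b : E => ‖inFibre (p := p) b rfl‖) (𝓝 0))
    (tendsto_comap.mono_left inf_le_left) (tendsto_comap.mono_left inf_le_right) hV
  obtain ⟨S, ⟨N, hN, hNS⟩, T, ⟨M, hM, hMT⟩, rfl⟩ := mem_inf_iff.1 h
  obtain ⟨ε, hε, hεM⟩ := Metric.mem_nhds_iff.1 hM
  refine ⟨N, hN, ε, hε, fun y hy b hb => ⟨hNS ?_, hMT (hεM ?_)⟩⟩
  · change p b.val ∈ N
    rwa [b.proj_val]
  · change ‖inFibre (p := p) b.val rfl‖ ∈ _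
    rw [norm_inFibre_val]
    simpa using hb

theorem exists_nhds_norm_lt {x : X} {a : Fibre p x} {c : ℝ} (h : ‖a‖ < c) :
    ∃ U ∈ 𝓝 a.val, ∀ (y : X) (b : Fibre p y), b.val ∈ U → ‖b‖ < c := by
  rw [← norm_inFibre_val] at h
  refine ⟨_, usc_norm (p := p) a.val c h, fun y b hb => ?_⟩
  rw [← norm_inFibre_val]
  exact hb

theorem eventually_exists_mem {x : X} (a : Fibre p x) {U : Set E} (hU : U ∈ 𝓝 a.val) :
    ∀ᶠ y in 𝓝 x, ∃ u : Fibre p y, u.val ∈ U := by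
  have h := (isOpenMap_proj (p := p)).image_mem_nhds hU
  rw [a.proj_val] at h
  filter_upwards [h]
  rintro _ ⟨u, hu, rfl⟩
  exact ⟨⟨u, rfl⟩, hu⟩

/-- Every point of the total space has a neighbourhood whose intersections with the fibres have
small diameter. -/
theorem exists_thin_nhds {x : X} (a : Fibre p x) {ε : ℝ} (hε : 0 < ε) :
    ∃ U : Set E, IsOpen U ∧ a.val ∈ U ∧
      ∀ (y : X) (b c : Fibre p y), b.val ∈ U → c.val ∈ U → ‖b - c‖ < ε := by
  have h0 : ‖a + (-1 : ℂ) • a‖ < ε := by simpa using hε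
  obtain ⟨W, hW, hWε⟩ := exists_nhds_norm_lt h0
  obtain ⟨U, hU, V, hV, hUV⟩ := exists_nhds_add a ((-1 : ℂ) • a) hW
  obtain ⟨V', hV', hVV'⟩ := exists_nhds_smul (-1) a hV
  obtain ⟨T, hT, hTo, haT⟩ := mem_nhds_iff.1 (inter_mem hU hV')
  refine ⟨T, hTo, haT, fun y b c hb hc => ?_⟩
  have := hWε y _ (hUV y b _ (hT hb).1 (hVV' y c (hT hc).2))
  simpa [sub_eq_add_neg] using this

/-- A section `f` is almost continuous at `x`, up to `ε`, if close to `x` it stays within distance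
`ε` (fibrewise) of any given neighbourhood of `f x` in the total space. -/
def AlmostContinuousAt (f : ∀ x, Fibre p x) (ε : ℝ) (x : X) : Prop :=
  ∀ U ∈ 𝓝 (f x).val, ∀ᶠ y in 𝓝 x, ∃ u : Fibre p y, u.val ∈ U ∧ ‖f y - u‖ < ε

namespace AlmostContinuousAt

variable {f g : ∀ x, Fibre p x} {ε δ : ℝ} {x : X}

theorem mono (hf : AlmostContinuousAt f ε x) (h : ε ≤ δ) : AlmostContinuousAt f δ x := by
  intro U hU
  filter_upwards [hf U hU]
  rintro y ⟨u, hu, hfu⟩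
  exact ⟨u, hu, hfu.trans_le h⟩

theorem congr (hf : AlmostContinuousAt f ε x) (h : ∀ᶠ y in 𝓝 x, f y = g y) :
    AlmostContinuousAt g ε x := by
  intro U hU
  rw [← h.self_of_nhds] at hU
  filter_upwards [hf U hU, h]
  rintro y ⟨u, hu, hfu⟩ hy
  exact ⟨u, hu, by rwa [← hy]⟩

theorem add (hf : AlmostContinuousAt f ε x) (hg : AlmostContinuousAt g δ x) :
    AlmostContinuousAt (f + g) (ε + δ) x := by
  intro W hW
  obtain ⟨U, hU, V, hV, hUV⟩ := exists_nhds_add (f x) (g x) hW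
  filter_upwards [hf U hU, hg V hV]
  rintro y ⟨u, hu, hfu⟩ ⟨v, hv, hgv⟩
  refine ⟨u + v, hUV y u v hu hv, ?_⟩
  rw [Pi.add_apply, add_sub_add_comm]
  exact (norm_add_le _ _).trans_lt (add_lt_add hfu hgv)

/-- No continuity is needed for a section that is small compared with `ε`: since `p` is open, every
neighbourhood of `f x` meets the fibres over points close to `x`. -/
theorem of_norm_le (h : ∀ y, ‖f y‖ ≤ δ) (hδ : 2 * δ < ε) : AlmostContinuousAt f ε x := by
  intro U hU
  have h1 : ‖f x‖ < ε - δ := (h x).trans_lt (by linarith)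
  obtain ⟨V, hV, hVε⟩ := exists_nhds_norm_lt h1
  filter_upwards [eventually_exists_mem (f x) (inter_mem hU hV)]
  rintro y ⟨u, hu, hu'⟩
  refine ⟨u, hu, (norm_sub_le _ _).trans_lt ?_⟩
  have := hVε y u hu'
  linarith [h y]

theorem smul (hf : AlmostContinuousAt f ε x) {φ : X → ℝ} (hφ : ContinuousAt φ x)
    (hφ0 : 0 ≤ φ x) (hδ : 0 < δ) :
    AlmostContinuousAt (fun y => (φ y : ℂ) • f y) (φ x * ε + δ) x := by
  intro W hW
  obtain ⟨U, hU, hUW⟩ := exists_nhds_smul (φ x : ℂ) (f x) hW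
  obtain ⟨V, hV, hVn⟩ := exists_nhds_norm_lt (lt_add_one ‖f x‖)
  have hlim : Tendsto (fun y => |φ y| * ε + |φ y - φ x| * (‖f x‖ + 1)) (𝓝 x)
      (𝓝 (|φ x| * ε + |φ x - φ x| * (‖f x‖ + 1))) :=
    (hφ.abs.mul_const ε).add ((hφ.sub_const (φ x)).abs.mul_const _)
  have hev := hlim.eventually_lt_const (u := φ x * ε + δ) (by
    rw [abs_of_nonneg hφ0, sub_self, abs_zero, zero_mul]
    linarith)
  filter_upwards [hf _ (inter_mem hU hV), hev]
  rintro y ⟨u, ⟨hu, hu'⟩, hfu⟩ hy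
  refine ⟨(φ x : ℂ) • u, hUW y u hu, lt_of_le_of_lt ?_ hy⟩
  have h1 : (φ y : ℂ) • f y - (φ x : ℂ) • u =
      (φ y : ℂ) • (f y - u) + ((φ y - φ x : ℝ) : ℂ) • u := by
    push_cast
    rw [smul_sub, sub_smul]
    abel
  rw [h1]
  refine (norm_add_le _ _).trans ?_
  rw [norm_smul, norm_smul, Complex.norm_real, Complex.norm_real, Real.norm_eq_abs,
    Real.norm_eq_abs]
  gcongr
  exact (hVn y u hu').le

theorem sum {ι : Type*} (I : Finset ι) {F : ι → ∀ x, Fibre p x} {e : ι → ℝ}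
    (h : ∀ i ∈ I, AlmostContinuousAt (F i) (e i) x) (hδ : 0 < δ) :
    AlmostContinuousAt (∑ i ∈ I, F i) ((∑ i ∈ I, e i) + δ) x := by
  classical
  induction I using Finset.induction_on with
  | empty =>
    refine of_norm_le (δ := 0) (fun y => ?_) (by simpa using hδ)
    simp
  | insert i I hi ih =>
    rw [Finset.sum_insert hi, Finset.sum_insert hi, add_assoc]
    exact (h i (Finset.mem_insert_self i I)).add
      (ih fun j hj => h j (Finset.mem_insert_of_mem hj))

/-- A section that is almost continuous up to every `ε > 0` is continuous. -/
theorem continuousAt (h : ∀ ε > 0, AlmostContinuousAt f ε x) :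
    ContinuousAt (fun y => (f y).val) x := by
  intro W hW
  change W ∈ 𝓝 (f x).val at hW
  rw [← add_zero (f x)] at hW
  obtain ⟨U, hU, V, hV, hUV⟩ := exists_nhds_add (f x) 0 hW
  obtain ⟨N, hN, ε, hε, hNV⟩ := exists_nhds_zero hV
  change ∀ᶠ y in 𝓝 x, (f y).val ∈ W
  filter_upwards [h ε hε U hU, hN]
  rintro y ⟨u, hu, hfu⟩ hy
  have := hUV y u (f y - u) hu (hNV y hy _ hfu)
  rwa [add_sub_cancel] at this

theorem of_continuousAt (h : ContinuousAt (fun y => (f y).val) x) (hε : 0 < ε) :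
    AlmostContinuousAt f ε x := by
  intro U hU
  filter_upwards [h.preimage_mem_nhds hU] with y hy
  exact ⟨f y, hy, by simpa using hε⟩

theorem partitionOfUnity {ι : Type*} (ρ : PartitionOfUnity ι X) {V : ι → Set X}
    (hρ : ρ.IsSubordinate V) {F : ι → ∀ x, Fibre p x}
    (h : ∀ i, x ∈ V i → AlmostContinuousAt (F i) ε x) (hδ : ε < δ) :
    AlmostContinuousAt (fun y => ∑ᶠ i, (ρ i y : ℂ) • F i y) δ x := by
  set I := ρ.fintsupport x
  set η : ℝ := (δ - ε) / 2 with hη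
  have hη0 : 0 < η := by rw [hη]; linarith
  have hI : (0 : ℝ) < I.card + 1 := by positivity
  have h1 : ∀ i ∈ I, AlmostContinuousAt (fun y => (ρ i y : ℂ) • F i y)
      (ρ i x * ε + η / (I.card + 1)) x := fun i hi =>
    (h i (hρ i ((ρ.mem_fintsupport_iff x i).1 hi))).smul (ρ i).continuous.continuousAt
      (ρ.nonneg i x) (div_pos hη0 hI)
  -- the weights `ρ i x` add up to one, and the errors to at most `2 * η = δ - ε`
  have h2 := (sum I h1 hη0).mono (δ := δ) (by
    rw [Finset.sum_add_distrib, ← Finset.sum_mul,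
      ρ.sum_finsupport' (Set.mem_univ x) (ρ.finsupport_subset_fintsupport x), Finset.sum_const,
      nsmul_eq_mul, ← mul_div_assoc]
    have h3 : (I.card : ℝ) * η / (I.card + 1) ≤ η := by
      rw [div_le_iff₀ hI]
      nlinarith
    linarith)
  refine h2.congr ?_
  filter_upwards [ρ.eventually_finsupport_subset x] with y hy
  rw [Finset.sum_apply, finsum_eq_sum_of_support_subset]
  intro i hi
  refine hy ((ρ.mem_finsupport y).2 fun h0 => hi ?_)
  change (ρ i y : ℂ) • F i y = 0
  rw [show ρ i y = 0 from h0, Complex.ofReal_zero, zero_smul]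

end AlmostContinuousAt

theorem norm_finsum_sub_le {ι : Type*} (ρ : PartitionOfUnity ι X) {V : ι → Set X}
    (hρ : ρ.IsSubordinate V) {y : X} {F : ι → Fibre p y} {b : Fibre p y} {ε : ℝ}
    (h : ∀ i, y ∈ V i → ‖F i - b‖ ≤ ε) : ‖(∑ᶠ i, (ρ i y : ℂ) • F i) - b‖ ≤ ε := by
  have h1 := ρ.sum_finsupport (Set.mem_univ y)
  have h2 : ∑ᶠ i, (ρ i y : ℂ) • F i = ∑ i ∈ ρ.finsupport y, (ρ i y : ℂ) • F i := by
    refine finsum_eq_sum_of_support_subset _ fun i hi => ?_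
    refine (ρ.mem_finsupport y).2 fun h0 => hi ?_
    change (ρ i y : ℂ) • F i = 0
    rw [show ρ i y = 0 from h0, Complex.ofReal_zero, zero_smul]
  have h3 : b = ∑ i ∈ ρ.finsupport y, (ρ i y : ℂ) • b := by
    rw [← Finset.sum_smul, ← Complex.ofReal_sum, h1, Complex.ofReal_one, one_smul]
  rw [h2]
  conv_lhs => rw [h3]
  rw [← Finset.sum_sub_distrib]
  refine (norm_sum_le _ _).trans ?_
  have h4 : ε = ∑ i ∈ ρ.finsupport y, ρ i y * ε := by rw [← Finset.sum_mul, h1, one_mul]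
  rw [h4]
  refine Finset.sum_le_sum fun i hi => ?_
  rw [← smul_sub, norm_smul, Complex.norm_real, Real.norm_of_nonneg (ρ.nonneg i y)]
  exact mul_le_mul_of_nonneg_left
    (h i (hρ i (subset_tsupport _ ((ρ.mem_finsupport y).1 hi)))) (ρ.nonneg i y)

/-- Close to `x`, values of the refinement are chosen in a thin neighbourhood of `f x`. -/
theorem exists_local_refinement [T1Space X] {f : ∀ x, Fibre p x} {ε δ : ℝ}
    (hf : ∀ x, AlmostContinuousAt f ε x) (hδ : 0 < δ) (x₀ x : X) :
    ∃ V : Set X, IsOpen V ∧ x ∈ V ∧ ∃ g : ∀ x, Fibre p x, ∀ y ∈ V,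
      AlmostContinuousAt g δ y ∧ ‖g y - f y‖ ≤ ε ∧ (y = x₀ → g y = f y) := by
  have hε : 0 < ε := by
    obtain ⟨u, -, hu⟩ := (hf x Set.univ univ_mem).self_of_nhds
    exact (norm_nonneg _).trans_lt hu
  obtain ⟨U, hUo, hfU, hU⟩ := exists_thin_nhds (f x) hδ
  have h1 : ∀ᶠ y in 𝓝 x, y = x₀ → y = x := by
    by_cases hx : x = x₀
    · exact Eventually.of_forall fun y hy => hy.trans hx.symm
    · filter_upwards [isOpen_ne.mem_nhds hx] with y hy h
      exact absurd h hy
  obtain ⟨V, hV, hVo, hxV⟩ := mem_nhds_iff.1 ((hf x U (hUo.mem_nhds hfU)).and h1)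
  have h2 : ∀ y ∈ V, ∃ u : Fibre p y, u.val ∈ U ∧ ‖f y - u‖ < ε ∧ (y = x₀ → u = f y) := by
    intro y hy
    obtain ⟨⟨u, hu, hfu⟩, hyx⟩ := hV hy
    by_cases hy0 : y = x₀
    · obtain rfl := hyx hy0
      exact ⟨f y, hfU, by simpa using hε, fun _ => rfl⟩
    · exact ⟨u, hu, hfu, fun h => absurd h hy0⟩
  choose! g hg using h2
  refine ⟨V, hVo, hxV, g, fun y hy => ⟨fun W hW => ?_, ?_, (hg y hy).2.2⟩⟩
  · filter_upwards [eventually_exists_mem (g y) (inter_mem hW (hUo.mem_nhds (hg y hy).1)),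
      hVo.mem_nhds hy]
    rintro z ⟨w, hw, hw'⟩ hz
    exact ⟨w, hw, hU z _ _ (hg z hz).1 hw'⟩
  · rw [norm_sub_rev]
    exact (hg y hy).2.1.le

theorem exists_refinement [T2Space X] [ParacompactSpace X] {f : ∀ x, Fibre p x} {ε δ : ℝ}
    (hf : ∀ x, AlmostContinuousAt f ε x) (hδ : 0 < δ) (x₀ : X) :
    ∃ g : ∀ x, Fibre p x, (∀ x, AlmostContinuousAt g δ x) ∧ (∀ x, ‖g x - f x‖ ≤ ε) ∧
      g x₀ = f x₀ := by
  choose V hVo hxV F hF using exists_local_refinement hf (half_pos hδ) x₀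
  obtain ⟨ρ, hρ⟩ := PartitionOfUnity.exists_isSubordinate isClosed_univ V hVo
    fun x _ => Set.mem_iUnion.2 ⟨x, hxV x⟩
  refine ⟨fun y => ∑ᶠ i, (ρ i y : ℂ) • F i y, fun x => ?_, fun x => ?_, ?_⟩
  · exact AlmostContinuousAt.partitionOfUnity ρ hρ (fun i hi => (hF i x hi).1) (half_lt_self hδ)
  · exact norm_finsum_sub_le ρ hρ fun i hi => (hF i x hi).2.1
  · rw [← sub_eq_zero, ← norm_le_zero_iff]
    refine norm_finsum_sub_le ρ hρ fun i hi => ?_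
    rw [(hF i x₀ hi).2.2 rfl, sub_self, norm_zero]

/-- Upper semicontinuous Banach bundles over paracompact Hausdorff spaces have enough continuous
sections (Douady and dal Soglio-Hérault): the section that is zero off `x₀` is improved
successively by partitions of unity, keeping its value at `x₀`, and the uniform limit is
continuous. -/
theorem exists_continuous_section [T2Space X] [ParacompactSpace X] (x₀ : X) (b : Fibre p x₀) :
    ∃ f : ∀ x, Fibre p x, Continuous (fun x => (f x).val) ∧ f x₀ = b := by
  classical
  -- `M` is large enough for the section `f₀` below to be almost continuous up to `M`
  set M : ℝ := 2 * ‖b‖ + 1 with hM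
  have hM0 : 0 < M := by positivity
  let f₀ : ∀ x, Fibre p x := fun x => if h : x₀ = x then h ▸ b else 0
  have hf₀ : f₀ x₀ = b := by simp [f₀]
  have hf₀M : ∀ x, AlmostContinuousAt f₀ (M / 2 ^ 0) x := by
    intro x
    refine AlmostContinuousAt.of_norm_le (δ := ‖b‖) (fun y => ?_) (by simp [hM])
    by_cases h : x₀ = y
    · subst h
      rw [hf₀]
    · simp [f₀, h]
  have hstep : ∀ (n : ℕ) (f : {f : ∀ x, Fibre p x // ∀ x, AlmostContinuousAt f (M / 2 ^ n) x}),
      ∃ g : {f : ∀ x, Fibre p x // ∀ x, AlmostContinuousAt f (M / 2 ^ (n + 1)) x},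
        (∀ x, ‖g.1 x - f.1 x‖ ≤ M / 2 ^ n) ∧ g.1 x₀ = f.1 x₀ := by
    rintro n ⟨f, hf⟩
    obtain ⟨g, h1, h2, h3⟩ :=
      exists_refinement hf (show 0 < M / 2 ^ (n + 1) by positivity) x₀
    exact ⟨⟨g, h1⟩, h2, h3⟩
  choose next hnext using hstep
  let F : ∀ n, {f : ∀ x, Fibre p x // ∀ x, AlmostContinuousAt f (M / 2 ^ n) x} :=
    fun n => Nat.rec ⟨f₀, hf₀M⟩ (fun n f => next n f) n
  have hF : ∀ n, (∀ x, ‖(F (n + 1)).1 x - (F n).1 x‖ ≤ M / 2 ^ n) ∧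
      (F (n + 1)).1 x₀ = (F n).1 x₀ := fun n => hnext n (F n)
  have hFx₀ : ∀ n, (F n).1 x₀ = b := by
    intro n
    induction n with
    | zero => exact hf₀
    | succ n ih => rw [(hF n).2, ih]
  have hdist : ∀ x n, dist ((F n).1 x) ((F (n + 1)).1 x) ≤ 2 * M / 2 / 2 ^ n := by
    intro x n
    rw [dist_comm, dist_eq_norm, mul_div_cancel_left₀ _ (two_ne_zero' ℝ)]
    exact (hF n).1 x
  have hlim : ∀ x, ∃ a, Tendsto (fun n => (F n).1 x) atTop (𝓝 a) := fun x =>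
    cauchySeq_tendsto_of_complete (cauchySeq_of_le_geometric_two (hdist x))
  choose f hf using hlim
  have hfF : ∀ n x, ‖f x - (F n).1 x‖ ≤ 2 * M / 2 ^ n := by
    intro n x
    rw [← dist_eq_norm, dist_comm]
    exact dist_le_of_le_geometric_two_of_tendsto (hdist x) (hf x) n
  refine ⟨f, continuous_iff_continuousAt.2 fun x => ?_, ?_⟩
  · refine AlmostContinuousAt.continuousAt fun ε hε => ?_
    obtain ⟨n, hn⟩ : ∃ n : ℕ, 6 * M / 2 ^ n < ε := by
      have h0 : Tendsto (fun n : ℕ => 6 * M * (1 / 2 : ℝ) ^ n) atTop (𝓝 (6 * M * 0)) :=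
        (tendsto_pow_atTop_nhds_zero_of_lt_one (by norm_num) (by norm_num)).const_mul _
      rw [mul_zero] at h0
      obtain ⟨n, hn⟩ := (h0.eventually_lt_const hε).exists
      exact ⟨n, by simpa [div_eq_mul_inv] using hn⟩
    have h1 : AlmostContinuousAt (f - (F n).1) (5 * M / 2 ^ n) x :=
      AlmostContinuousAt.of_norm_le (δ := 2 * M / 2 ^ n) (hfF n) (by
        have h3 : 0 < M / 2 ^ n := by positivity
        rw [show 2 * (2 * M / 2 ^ n) = 4 * (M / 2 ^ n) by ring,
          show 5 * M / 2 ^ n = 5 * (M / 2 ^ n) by ring]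
        linarith)
    have h2 := ((F n).2 x).add h1
    rw [add_sub_cancel] at h2
    refine h2.mono (le_of_eq_of_le ?_ hn.le)
    ring
  · refine tendsto_nhds_unique (hf x₀) ?_
    simp only [hFx₀]
    exact tendsto_const_nhds

/-- In a bundle over a locally compact space the continuous section through a given point can be
cut off to have compact support. -/
theorem exists_compactlySupported_section [T2Space X] [LocallyCompactSpace X] [ParacompactSpace X]
    (x₀ : X) (b : Fibre p x₀) : ∃ f : ∀ x, Fibre p x, Continuous (fun x => (f x).val) ∧
      (∃ C : Set X, IsCompact C ∧ ∀ x ∉ C, f x = 0) ∧ f x₀ = b := by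
  obtain ⟨f, hf, hfx₀⟩ := exists_continuous_section x₀ b
  obtain ⟨φ, hφ1, -, hφc, hφ⟩ := exists_continuous_one_zero_of_isCompact
    (isCompact_singleton (x := x₀)) isClosed_empty (Set.disjoint_empty _)
  refine ⟨fun x => (φ x : ℂ) • f x, continuous_iff_continuousAt.2 fun x => ?_,
    ⟨tsupport φ, hφc, fun x hx => ?_⟩, ?_⟩
  · refine AlmostContinuousAt.continuousAt fun ε hε => ?_
    have h1 : 0 < ε / 2 := half_pos hε
    have h2 := (AlmostContinuousAt.of_continuousAt hf.continuousAt h1).smul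
      φ.continuous.continuousAt (hφ x).1 h1
    refine h2.mono ?_
    have := mul_le_mul_of_nonneg_right (hφ x).2 h1.le
    linarith
  · have : φ x = 0 := image_eq_zero_of_notMem_tsupport hx
    simp [this]
  · have : φ x₀ = 1 := hφ1 rfl
    simp [this, hfx₀]

end USCBanachBundle

end Selection

/-! ### Generators and quotients of `*`-algebras -/

section Generators

/-- A closed `*`-subalgebra that contains the images of generators contains all images. -/
theorem map_mem_of_generators {A : Type*} [NonUnitalCStarAlgebra A]
    {H : Type*} [NormedAddCommGroup H] [InnerProductSpace ℂ H] [CompleteSpace H] {S : Set A}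
    {B : NonUnitalStarSubalgebra ℂ A}
    (hB : B = (NonUnitalStarAlgebra.adjoin ℂ S).topologicalClosure)
    (L : B →⋆ₙₐ[ℂ] (H →L[ℂ] H)) (C : NonUnitalStarSubalgebra ℂ (H →L[ℂ] H))
    (hC : IsClosed (C : Set (H →L[ℂ] H))) (h : ∀ x : B, x.1 ∈ S → L x ∈ C) (x : B) : L x ∈ C := by
  have hcl : IsClosed (B : Set A) := by
    rw [hB]
    exact NonUnitalStarSubalgebra.isClosed_topologicalClosure _
  have hSB : S ⊆ B := by
    rw [hB]
    exact (NonUnitalStarAlgebra.subset_adjoin ℂ S).trans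
      (NonUnitalStarSubalgebra.le_topologicalClosure _)
  have hL : Continuous L := AddMonoidHomClass.continuous_of_bound L 1 fun x => by
    rw [one_mul]; exact NonUnitalStarAlgHom.norm_apply_le L x
  have hle : B ≤ (C.comap L).map (NonUnitalStarSubalgebraClass.subtype B) := by
    conv_lhs => rw [hB]
    refine NonUnitalStarSubalgebra.topologicalClosure_minimal _ ?_ ?_
    · refine NonUnitalStarAlgebra.adjoin_le fun s hs => ?_
      exact ⟨⟨s, hSB hs⟩, h _ hs, rfl⟩
    · exact hcl.isClosedEmbedding_subtypeVal.isClosedMap _ (hC.preimage hL)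
  obtain ⟨y, hy, hyx⟩ := hle x.2
  rwa [Subtype.ext hyx] at hy

end Generators

section Factor

variable {A B C : Type*} [NonUnitalRing A] [Module ℂ A] [StarRing A] [NonUnitalRing B] [Module ℂ B]
  [StarRing B] [NonUnitalRing C] [Module ℂ C] [StarRing C]

theorem exists_factor_of_surjective (q : A →⋆ₙₐ[ℂ] B) (hq : Function.Surjective q)
    (ρ : A →⋆ₙₐ[ℂ] C) (h : ∀ a, q a = 0 → ρ a = 0) :
    ∃ ρ' : B →⋆ₙₐ[ℂ] C, ∀ a, ρ' (q a) = ρ a := by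
  have key : ∀ a b, q a = q b → ρ a = ρ b := by
    intro a b hab
    rw [← sub_eq_zero, ← map_sub]
    exact h _ (by rw [map_sub, hab, sub_self])
  let s := Function.surjInv hq
  have hs : ∀ b, q (s b) = b := Function.surjInv_eq hq
  refine ⟨{ toFun := fun b => ρ (s b)
            map_smul' := fun c a => ?_
            map_zero' := ?_
            map_add' := fun a b => ?_
            map_mul' := fun a b => ?_
            map_star' := fun a => ?_ }, fun a => key _ _ (hs _)⟩
  · exact (key _ _ (by rw [hs, map_smul, hs])).trans (map_smul ρ c (s a))
  · exact h _ (hs 0)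
  · exact (key _ _ (by rw [hs, map_add, hs, hs])).trans (map_add ρ (s a) (s b))
  · exact (key _ _ (by rw [hs, map_mul, hs, hs])).trans (map_mul ρ (s a) (s b))
  · exact (key _ _ (by rw [hs, map_star, hs])).trans (map_star ρ (s a))

variable {H : Type*} [NormedAddCommGroup H] [InnerProductSpace ℂ H] [CompleteSpace H]

theorem IsIrreducibleRep.comp_surjective {σ : B →⋆ₙₐ[ℂ] (H →L[ℂ] H)} (hσ : IsIrreducibleRep σ)
    {q : A →⋆ₙₐ[ℂ] B} (hq : Function.Surjective q) : IsIrreducibleRep (σ.comp q) := by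
  refine ⟨?_, fun M hM h => hσ.2 M hM fun b ξ hξ => ?_⟩
  · obtain ⟨b, hb⟩ := hσ.1
    obtain ⟨a, rfl⟩ := hq b
    exact ⟨a, hb⟩
  · obtain ⟨a, rfl⟩ := hq b
    exact h a ξ hξ

/-- The representation `a ↦ ρ a e` for a projection `e` in the commutant of `ρ`, which is the
subrepresentation on the range of `e`, extended by zero. -/
noncomputable def compress (ρ : A →⋆ₙₐ[ℂ] (H →L[ℂ] H)) (e : H →L[ℂ] H) (he : IsStarProjection e)
    (hc : ∀ a, Commute e (ρ a)) : A →⋆ₙₐ[ℂ] (H →L[ℂ] H) where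
  toFun a := ρ a * e
  map_smul' c a := by
    rw [map_smul, smul_mul_assoc]
    rfl
  map_zero' := by rw [map_zero, zero_mul]
  map_add' a b := by rw [map_add, add_mul]
  map_mul' a b := by
    rw [map_mul, mul_assoc (ρ a) e, ← mul_assoc e, (hc b).eq, mul_assoc (ρ b), he.1.eq, mul_assoc]
  map_star' a := by rw [map_star, star_mul, he.2.star_eq, ← map_star, (hc _).eq]

end Factor

/-! ### Locally closed points of the primitive ideal space -/

section LocallyClosed

variable {R : Type w} [NonUnitalRing R] [Module ℂ R] [StarRing R]

/-- The sets `{Q | c ∉ Q}` are a basis of the hull-kernel topology, since primitive ideals are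
prime. -/
theorem Prim.exists_notMem_of_isOpen {U : Set (Prim R)} (hU : IsOpen U) {P : Prim R} (hP : P ∈ U) :
    ∃ c ∉ P.1, ∀ Q : Prim R, c ∉ Q.1 → Q ∈ U := by
  obtain ⟨K, _, _, _, ρ, hρ, hPρ⟩ := P.2
  have hmem : ∀ a, a ∉ P.1 ↔ ρ a ≠ 0 := fun a => by rw [hPρ, TwoSidedIdeal.mem_ker]
  induction hU with
  | basic U hU =>
    obtain ⟨a, rfl⟩ := hU
    exact ⟨a, hP, fun Q hQ => hQ⟩
  | univ =>
    obtain ⟨a, ha⟩ := hρ.1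
    exact ⟨a, (hmem a).2 ha, fun _ _ => trivial⟩
  | inter U V _ _ ihU ihV =>
    obtain ⟨a, ha, haU⟩ := ihU hP.1
    obtain ⟨b, hb, hbV⟩ := ihV hP.2
    obtain ⟨c, hc⟩ := hρ.exists_mul_mul_ne_zero ((hmem a).1 ha) ((hmem b).1 hb)
    refine ⟨a * c * b, (hmem _).2 hc, fun Q hQ => ⟨haU Q fun h => hQ ?_, hbV Q fun h => hQ ?_⟩⟩
    · exact Q.1.mul_mem_right _ _ (Q.1.mul_mem_right _ _ h)
    · exact Q.1.mul_mem_left _ _ h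
  | sUnion S _ ih =>
    obtain ⟨U, hU, hPU⟩ := hP
    obtain ⟨c, hc, hcU⟩ := ih U hU hPU
    exact ⟨c, hc, fun Q hQ => ⟨U, hU, hcU Q hQ⟩⟩

/-- If `P` is locally closed, some element outside `P` lies in every primitive ideal that properly
contains `P`. -/
theorem Prim.exists_notMem_of_isLocallyClosed {P : Prim R}
    (hP : IsLocallyClosed ({P} : Set (Prim R))) :
    ∃ c ∉ P.1, ∀ Q : Prim R, (∀ a ∈ P.1, a ∈ Q.1) → c ∉ Q.1 → Q = P := by
  obtain ⟨U, Z, hU, hZ, hUZ⟩ := hP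
  have hPU : P ∈ U ∩ Z := hUZ ▸ Set.mem_singleton P
  obtain ⟨c, hc, hcU⟩ := Prim.exists_notMem_of_isOpen hU hPU.1
  refine ⟨c, hc, fun Q hPQ hQ => ?_⟩
  have hQZ : Q ∈ Z := by
    by_contra hQZ
    obtain ⟨b, hb, hbZ⟩ := Prim.exists_notMem_of_isOpen hZ.isOpen_compl (P := Q) hQZ
    exact hbZ P (fun h => hb (hPQ b h)) hPU.2
  have : Q ∈ U ∩ Z := ⟨hcU Q hQ, hQZ⟩
  rwa [← hUZ] at this

end LocallyClosed

/-! ### Evaluation of sections at a unit -/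

section Evaluation

variable {G : Type u} [TopologicalSpace G] [TopGroupoid G] {E : Type v} [TopologicalSpace E]
  {p : E → G} [FellBundle p]

open TopGroupoid

theorem continuous_rng : Continuous (rng : G → G) := by
  have h : Continuous fun x : G => gmul x (ginv x) :=
    continuousOn_gmul.comp_continuous (continuous_id.prodMk continuous_ginv)
      fun x => (rng_ginv x).symm
  simpa only [gmul_ginv] using h

theorem isClosed_unitSpace [T2Space G] : IsClosed {x : G | rng x = x} :=
  isClosed_eq continuous_rng continuous_id

variable (p) in
/-- The evaluation `A → A(u)` of sections at a unit `u`. -/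
noncomputable def evalAt (u : UnitSpace G) : sectionAlgebra p →⋆ₙₐ[ℂ] Fibre p u.1 where
  toFun f := f.1 u
  map_smul' _ _ := rfl
  map_zero' := rfl
  map_add' _ _ := rfl
  map_mul' _ _ := rfl
  map_star' _ := rfl

theorem evalAt_surjective [T2Space G] [LocallyCompactSpace G] [SecondCountableTopology G]
    (u : UnitSpace G) : Function.Surjective (evalAt p u) := by
  intro b
  obtain ⟨f, hf, ⟨C, hC, hfC⟩, hfu⟩ := USCBanachBundle.exists_compactlySupported_section u.1 b
  refine ⟨⟨fun v => f v.1, hf.comp continuous_subtype_val, ?_⟩, hfu⟩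
  have hC' : IsCompact ((Subtype.val : UnitSpace G → G) ⁻¹' C) :=
    isClosed_unitSpace.isClosedEmbedding_subtypeVal.isCompact_preimage hC
  refine tendsto_const_nhds.congr' ?_
  filter_upwards [hC'.compl_mem_cocompact] with v hv
  rw [hfC v.1 hv, norm_zero]

/-- If `I(u) ⊆ P`, then `P` is the inverse image in `A` of `P` regarded as an ideal of `A(u)`. -/
theorem evalAt_mem_idealAt_iff {P : Prim (sectionAlgebra p)} {u : UnitSpace G}
    (hq : Function.Surjective (evalAt p u)) (hP : IsStructurePoint P u) (f : sectionAlgebra p) :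
    evalAt p u f ∈ idealAt P u ↔ f ∈ P.1 := by
  refine ⟨fun h => ?_, fun h => (TwoSidedIdeal.mem_sInf _).2 fun J hJ => hJ.2 f h⟩
  obtain ⟨K, _, _, _, ρ, -, hPρ⟩ := P.2
  obtain ⟨ρ', hρ'⟩ := exists_factor_of_surjective (evalAt p u) hq ρ fun a ha => by
    rw [← TwoSidedIdeal.mem_ker, ← hPρ]
    exact hP a ha
  have hc : Continuous ρ' := AddMonoidHomClass.continuous_of_bound ρ' 1 fun x => by
    rw [one_mul]; exact NonUnitalStarAlgHom.norm_apply_le ρ' x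
  have h1 : evalAt p u f ∈ TwoSidedIdeal.ker ρ' := by
    refine (TwoSidedIdeal.mem_sInf _).1 h _ ⟨?_, fun g hg => ?_⟩
    · have : (TwoSidedIdeal.ker ρ' : Set (Fibre p u.1)) = ρ' ⁻¹' {0} := by
        ext x
        exact TwoSidedIdeal.mem_ker ρ'
      rw [this]
      exact isClosed_singleton.preimage hc
    · have : ρ' (evalAt p u g) = 0 := by
        rw [hρ', ← TwoSidedIdeal.mem_ker, ← hPρ]
        exact hg
      exact (TwoSidedIdeal.mem_ker ρ').2 this
  rw [TwoSidedIdeal.mem_ker, hρ'] at h1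
  rwa [hPρ, TwoSidedIdeal.mem_ker]

/-- If `P` is locally closed, some `d` in `A(u)` outside `P` is annihilated by every representation
of `A(u)` whose kernel properly contains `P`. -/
theorem exists_notMem_idealAt [T2Space G] [LocallyCompactSpace G] [SecondCountableTopology G]
    {P : Prim (sectionAlgebra p)} (hP : IsLocallyClosed ({P} : Set (Prim (sectionAlgebra p))))
    {u : UnitSpace G} (hu : IsStructurePoint P u) :
    ∃ d ∉ idealAt P u, ∀ {H : Type w} [NormedAddCommGroup H] [InnerProductSpace ℂ H]
      [CompleteSpace H] (θ : Fibre p u.1 →⋆ₙₐ[ℂ] (H →L[ℂ] H)), (∀ a ∈ idealAt P u, θ a = 0) →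
      (∃ a ∉ idealAt P u, θ a = 0) → θ d = 0 := by
  have hq := evalAt_surjective (p := p) u
  have hmem := evalAt_mem_idealAt_iff hq hu
  obtain ⟨c, hc, hcP⟩ := Prim.exists_notMem_of_isLocallyClosed hP
  refine ⟨evalAt p u c, fun h => hc ((hmem c).1 h), ?_⟩
  rintro H _ _ _ θ hθ ⟨a, ha, hθa⟩
  by_contra hd
  obtain ⟨K, _, _, _, σ, hσ, hσd, hσθ⟩ := exists_isIrreducibleRep.{u} θ hd
  have hQ := hcP ⟨TwoSidedIdeal.ker (σ.comp (evalAt p u)), K, _, _, _, σ.comp (evalAt p u),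
    hσ.comp_surjective hq, rfl⟩
    (fun f hf => (TwoSidedIdeal.mem_ker _).2 (hσθ _ (hθ _ ((hmem f).2 hf))))
    (fun h => hσd ((TwoSidedIdeal.mem_ker _).1 h))
  obtain ⟨f, rfl⟩ := hq a
  refine ha ((hmem f).2 ?_)
  rw [← hQ]
  exact (TwoSidedIdeal.mem_ker _).2 (hσθ _ hθa)

end Evaluation

/-! ### Invariant subspaces of a representation and of its integrated form -/

section Invariant

variable {R : Type*} [NonUnitalRing R] [Module ℂ R] [StarRing R]
variable {H : Type*} [NormedAddCommGroup H] [InnerProductSpace ℂ H] [CompleteSpace H]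

open scoped InnerProductSpace

theorem apply_eq_zero_of_star_mul_self {T : H →L[ℂ] H} {ξ : H} (h : (star T * T) ξ = 0) :
    T ξ = 0 := by
  have h1 : ⟪ContinuousLinearMap.adjoint T (T ξ), ξ⟫_ℂ = 0 := by
    rw [show ContinuousLinearMap.adjoint T (T ξ) = 0 from h, inner_zero_left]
  rwa [ContinuousLinearMap.adjoint_inner_left, inner_self_eq_zero] at h1

/-- The projection onto the subrepresentation generated by an invariant set of vectors. -/
theorem exists_projection_of_invariant (ρ : R →⋆ₙₐ[ℂ] (H →L[ℂ] H)) {T : Set H}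
    (hT : ∀ a, ∀ t ∈ T, ρ a t ∈ T) : ∃ e : H →L[ℂ] H, IsStarProjection e ∧
      (∀ a, Commute e (ρ a)) ∧ ∀ a, ρ a * e = 0 ↔ ∀ t ∈ T, ρ a t = 0 := by
  set M := (Submodule.span ℂ T).topologicalClosure with hM
  have : CompleteSpace M := (Submodule.isClosed_topologicalClosure _).completeSpace_coe
  have hle : ∀ (S : Submodule ℂ H), IsClosed (S : Set H) → T ⊆ S → M ≤ S := fun S hS hTS =>
    Submodule.topologicalClosure_minimal _ (Submodule.span_le.2 hTS) hS
  have hTM : T ⊆ M := Submodule.subset_span.trans (Submodule.le_topologicalClosure _)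
  refine ⟨M.starProjection, isStarProjection_starProjection,
    commute_starProjection_of_invariant ρ fun a ξ hξ => ?_,
    fun a => ⟨fun h t ht => ?_, fun h => ?_⟩⟩
  · exact hle (M.comap (ρ a : H →ₗ[ℂ] H))
      ((Submodule.isClosed_topologicalClosure _).preimage (ρ a).continuous)
      (fun t ht => hTM (hT a t ht)) hξ
  · have h1 := DFunLike.congr_fun h t
    change ρ a (M.starProjection t) = 0 at h1
    rwa [Submodule.starProjection_eq_self_iff.2 (hTM ht)] at h1
  · refine ContinuousLinearMap.ext fun ξ => ?_
    exact hle (LinearMap.ker (ρ a : H →ₗ[ℂ] H)) (ContinuousLinearMap.isClosed_ker (ρ a)) h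
      (M.starProjection_apply_mem ξ)

theorem integral_mem_of_forall_mem {X : Type*} [MeasurableSpace X] {μ : Measure X}
    {M : Submodule ℂ H} (hM : IsClosed (M : Set H)) {g : X → H} (hg : ∀ x, g x ∈ M) :
    ∫ x, g x ∂μ ∈ M := by
  have : CompleteSpace M := hM.completeSpace_coe
  -- without integrability the integral is zero by convention
  by_cases hi : Integrable g μ
  · rw [← Submodule.starProjection_eq_self_iff, ← ContinuousLinearMap.integral_comp_comm _ hi]
    refine integral_congr_ae (Eventually.of_forall fun x => ?_)
    exact Submodule.starProjection_eq_self_iff.2 (hg x)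
  · rw [integral_undef hi]
    exact M.zero_mem

end Invariant

section FellRep

variable {G : Type u} [TopologicalSpace G] [TopGroupoid G] {E : Type v} [TopologicalSpace E]
  {p : E → G} [FellBundle p] {x₀ : UnitSpace G} {K : Subgroup (Isotropy x₀)}
  {H : Type*} [NormedAddCommGroup H] [InnerProductSpace ℂ H] [CompleteSpace H]

open BundleMulStar TopGroupoid
open scoped InnerProductSpace

namespace FellRep

variable (π : FellRep p K H)

/-- Multiplicativity of `π` for a product viewed in the fibre over any `m` equal to `k l`. -/
theorem map_bmul {k l m : K} (h : k * l = m) (a : Fibre p k.1.val) (b : Fibre p l.1.val)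
    {c : Fibre p m.1.val} (hc : c.val = bmul p a.val b.val) :
    π.toFun m c = π.toFun k a * π.toFun l b := by
  rw [← π.map_mul]
  exact π.congr h.symm hc

theorem map_bstar {k m : K} (h : k⁻¹ = m) (a : Fibre p k.1.val) {c : Fibre p m.1.val}
    (hc : c.val = bstar p a.val) : π.toFun m c = star (π.toFun k a) := by
  rw [← π.map_star]
  exact π.congr h.symm hc

theorem restrictUnit_kstar_kmul {k : K} (a b : Fibre p k.1.val) :
    π.restrictUnit (kmul (inv_mul_cancel k) (kstar rfl a) b) =
      star (π.toFun k a) * π.toFun k b := by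
  rw [← π.map_bstar rfl a (c := kstar rfl a) rfl]
  exact π.map_bmul (inv_mul_cancel k) _ _ rfl

variable {π} {μ : Measure K} [μ.IsHaarMeasure] {L : fellCStar p K μ →⋆ₙₐ[ℂ] (H →L[ℂ] H)}

theorem integratedForm_mem (hLπ : IsIntegratedForm μ L π) {M : Submodule ℂ H}
    (hM : IsClosed (M : Set H)) (h : ∀ k b, ∀ ξ ∈ M, π.toFun k b ξ ∈ M) (f : sectionsC p K)
    {ξ : H} (hξ : ξ ∈ M) : L (toFellCStar μ f) ξ ∈ M := by
  rw [hLπ]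
  exact integral_mem_of_forall_mem hM fun s => M.smul_of_tower_mem _ (h s _ ξ hξ)

theorem map_mem_of_toFellCStar_mem {μ : Measure K} (L : fellCStar p K μ →⋆ₙₐ[ℂ] (H →L[ℂ] H))
    (C : NonUnitalStarSubalgebra ℂ (H →L[ℂ] H)) (hC : IsClosed (C : Set (H →L[ℂ] H)))
    (h : ∀ f, L (toFellCStar μ f) ∈ C) (x : fellCStar p K μ) : L x ∈ C := by
  refine map_mem_of_generators (S := Set.range (universalRep μ)) rfl L C hC ?_ x
  rintro x ⟨f, hf⟩
  rw [← show toFellCStar μ f = x from Subtype.ext hf]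
  exact h f

set_option synthInstance.maxHeartbeats 400000 in
/-- A closed subspace invariant under `π` is invariant under the integrated form `L`. Its orthogonal
complement is invariant as well, so its projection commutes with the generators `L f` and their
adjoints. -/
theorem eq_bot_or_eq_top_of_invariant (hL : IsIrreducibleRep (R := fellCStar p K μ) L)
    (hLπ : IsIntegratedForm μ L π) {M : Submodule ℂ H} (hM : IsClosed (M : Set H))
    (h : ∀ k b, ∀ ξ ∈ M, π.toFun k b ξ ∈ M) : M = ⊥ ∨ M = ⊤ := by
  have : CompleteSpace M := hM.completeSpace_coe
  have h' : ∀ k b, ∀ ξ ∈ Mᗮ, π.toFun k b ξ ∈ Mᗮ := fun k b =>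
    mem_orthogonal_of_star (by rw [← π.map_star]; exact h _ _)
  have key : ∀ x, L x ∈ NonUnitalStarSubalgebra.centralizer ℂ {M.starProjection} :=
    map_mem_of_toFellCStar_mem L _ (Set.isClosed_centralizer _) (by
      intro f
      rw [NonUnitalStarSubalgebra.mem_centralizer_iff]
      rintro _ rfl
      rw [(isStarProjection_starProjection (U := M)).isSelfAdjoint.star_eq, and_self]
      exact commute_starProjection_of_orthogonal
        (fun ξ hξ => integratedForm_mem hLπ hM h f hξ)
        (fun ξ hξ => integratedForm_mem hLπ M.isClosed_orthogonal h' f hξ))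
  refine hL.2 M hM fun x ξ hξ => mem_of_commute_starProjection ?_ hξ
  exact ((NonUnitalStarSubalgebra.mem_centralizer_iff ℂ).1 (key x) _ rfl).1

set_option synthInstance.maxHeartbeats 400000 in
theorem exists_toFun_ne_zero (hL : IsIrreducibleRep (R := fellCStar p K μ) L)
    (hLπ : IsIntegratedForm μ L π) : ∃ k b, π.toFun k b ≠ 0 := by
  by_contra! h
  obtain ⟨x, hx⟩ := hL.1
  refine hx ((NonUnitalStarAlgebra.mem_bot).1 (map_mem_of_toFellCStar_mem L ⊥ ?_ (fun f => ?_) x))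
  · simp
  · rw [NonUnitalStarAlgebra.mem_bot]
    refine ContinuousLinearMap.ext fun ξ => ?_
    rw [hLπ]
    simp [h]

set_option synthInstance.maxHeartbeats 400000 in
theorem isNondegenerateRep_restrictUnit (hL : IsIrreducibleRep (R := fellCStar p K μ) L)
    (hLπ : IsIntegratedForm μ L π) : IsNondegenerateRep π.restrictUnit := by
  -- `b* b` lies in the fibre over the unit, so a vector annihilated by that fibre is
  -- annihilated by all of `π`
  have hN : ∀ ξ, (∀ a, π.restrictUnit a ξ = 0) → ∀ k b, π.toFun k b ξ = 0 := fun ξ hξ k b =>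
    apply_eq_zero_of_star_mul_self (by rw [← π.restrictUnit_kstar_kmul]; exact hξ _)
  have hbot : nullSubspace (fun a => π.restrictUnit a) = ⊥ := by
    refine (eq_bot_or_eq_top_of_invariant hL hLπ (isClosed_setOf_forall_eq_zero _)
      fun k b ξ hξ => ?_).resolve_right fun htop => ?_
    · rw [hN ξ hξ k b]
      exact Submodule.zero_mem _
    · obtain ⟨k, b, hkb⟩ := exists_toFun_ne_zero hL hLπ
      refine hkb (ContinuousLinearMap.ext fun ξ => hN ξ ?_ k b)
      have : ξ ∈ nullSubspace fun a => π.restrictUnit a := by rw [htop]; trivial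
      exact this
  rw [IsNondegenerateRep, Submodule.topologicalClosure_eq_top_iff, Submodule.eq_bot_iff]
  intro η hη
  rw [← Submodule.mem_bot ℂ, ← hbot]
  intro a
  have h0 : π.restrictUnit (star a) (π.restrictUnit a η) ∈
      Submodule.span ℂ {η : H | ∃ a ξ, η = π.restrictUnit a ξ} :=
    Submodule.subset_span ⟨star a, π.restrictUnit a η, rfl⟩
  have h1 := Submodule.inner_left_of_mem_orthogonal h0 hη
  rw [StarHomClass.map_star] at h1
  rwa [show ⟪η, star (π.restrictUnit a) (π.restrictUnit a η)⟫_ℂ =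
    ⟪π.restrictUnit a η, π.restrictUnit a η⟫_ℂ from
      ContinuousLinearMap.adjoint_inner_right _ _ _, inner_self_eq_zero] at h1

end FellRep

/-- For an ideal `J` invariant under `x`, an element `d` is in `J` as soon as all `c' d c*` with
`c`, `c'` in `B(x)` are, because the inner products `f* c'` and `c* g` of `B(x)` span dense subspaces. -/
theorem mem_of_forall_conj_mem {J : Set E} (hJ : IsClosedFibreIdeal p x₀ J) {x : Isotropy x₀}
    (hx : rieffel p x.val J = J) {d : E} (hd : p d = x₀.1)
    (h : ∀ c' c, p c' = x.val → p c = x.val → bmul p (bmul p c' d) (bstar p c) ∈ J) : d ∈ J := by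
  replace hd : p d = (1 : Isotropy x₀).val := hd
  have hxi := stab_inv hJ hx
  refine hJ.mem (closedSpan_le ?_ (iso_approx_right x hd))
  rintro t ht ⟨c, g, hc, hg, rfl⟩
  refine closedSpan_le ?_ (iso_approx_left x⁻¹ ht)
  rintro _ - ⟨f, e, hf, he, rfl⟩
  have hcs := iso_star hc rfl
  have hes := iso_star he (inv_inv x)
  have hdc := iso_proj hd hcs (one_mul _)
  have hed := iso_proj hes hd (mul_one _)
  -- regroup `(f e*) (d (c* g))` as `f (e* d c*) g`
  have hassoc : bmul p (bmul p f (bstar p e)) (bmul p d (bmul p (bstar p c) g)) =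
      bmul p (bmul p f (bmul p (bmul p (bstar p e) d) (bstar p c))) g := by
    rw [← iso_assoc hd hcs hg, iso_assoc hf hes (iso_proj hdc hg (inv_mul_cancel x)),
      ← iso_assoc hes hdc hg, ← iso_assoc hes hd hcs,
      iso_assoc hf (iso_proj hed hcs (mul_inv_cancel x)) hg]
  rw [hassoc]
  exact hJ.mem_span (conj_mem hJ hxi hf (h _ _ hes hc) (by rwa [inv_inv]))

end FellRep

/-! ### Homogeneity -/

section Homogeneous

variable {G : Type u} [TopologicalSpace G] [TopGroupoid G] {E : Type v} [TopologicalSpace E]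
  {p : E → G} [FellBundle p] {x₀ : UnitSpace G} {K : Subgroup (Isotropy x₀)}
  {H : Type*} [NormedAddCommGroup H] [InnerProductSpace ℂ H] [CompleteSpace H]

open BundleMulStar TopGroupoid

/-- Suppose that the kernel `N` of `π|_{A(u)}` is invariant under `K` and that `d ∉ N` annihilates
every subrepresentation of `π|_{A(u)}` with a kernel larger than `N`. Then the vectors annihilated
by the right ideal `d A(u)` form a subspace invariant under `π`. -/
theorem FellRep.toFun_mem_nullSubspace (π : FellRep p K H) {d : Fibre p x₀.1}
    (hd : π.restrictUnit d ≠ 0)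
    (hJ : IsClosedFibreIdeal p x₀ (Fibre.val '' {a : Fibre p x₀.1 | π.restrictUnit a = 0}))
    (hK : ∀ k : K, rieffel p k.1.val (Fibre.val '' {a : Fibre p x₀.1 | π.restrictUnit a = 0}) =
      Fibre.val '' {a : Fibre p x₀.1 | π.restrictUnit a = 0})
    (hsub : ∀ e : H →L[ℂ] H, IsStarProjection e → (∀ a, Commute e (π.restrictUnit a)) →
      (∃ a, π.restrictUnit a ≠ 0 ∧ π.restrictUnit a * e = 0) → π.restrictUnit d * e = 0)
    (k : K) (b : Fibre p k.1.val) {ξ : H}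
    (hξ : ξ ∈ nullSubspace fun a => π.restrictUnit d * π.restrictUnit a) :
    π.toFun k b ξ ∈ nullSubspace fun a => π.restrictUnit d * π.restrictUnit a := by
  -- the subrepresentation generated by the vectors `π(b) ξ` with `b` in the fibre over `k`
  obtain ⟨e, he, hec, heT⟩ := exists_projection_of_invariant π.restrictUnit
    (T := Set.range fun b : Fibre p k.1.val => π.toFun k b ξ) (by
      rintro a _ ⟨b, rfl⟩
      exact ⟨kmul (one_mul k) a b, DFunLike.congr_fun (π.map_bmul (one_mul k) a b rfl) ξ⟩)
  suffices h : ∃ a, π.restrictUnit a ≠ 0 ∧ π.restrictUnit a * e = 0 by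
    have hdT := (heT d).1 (hsub e he hec h)
    intro a
    have h1 : π.restrictUnit a (π.toFun k b ξ) = π.toFun k (kmul (one_mul k) a b) ξ :=
      (DFunLike.congr_fun (π.map_bmul (one_mul k) a b rfl) ξ).symm
    change π.restrictUnit d (π.restrictUnit a (π.toFun k b ξ)) = 0
    rw [h1]
    exact hdT _ ⟨_, rfl⟩
  by_contra! hne
  -- otherwise all products `c' d c*` act by zero, so that `d` itself does
  refine hd ?_
  have hmem : d.val ∈ Fibre.val '' {a : Fibre p x₀.1 | π.restrictUnit a = 0} := by
    refine mem_of_forall_conj_mem hJ (hK k) d.proj_val fun c' c hc' hc => ?_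
    let C' : Fibre p k.1.val := ⟨c', hc'⟩
    let C : Fibre p k.1.val := ⟨c, hc⟩
    let D : Fibre p k.1.val := kmul (mul_one k) C' d
    let S : Fibre p (k⁻¹ : K).1.val := kstar rfl C
    let a : Fibre p x₀.1 := kmul (mul_inv_cancel k) D S
    refine ⟨a, ?_, rfl⟩
    by_contra ha
    refine hne a ha ((heT a).2 ?_)
    rintro _ ⟨b, rfl⟩
    have h1 : π.restrictUnit a = π.toFun k D * star (π.toFun k C) := by
      rw [← π.map_bstar rfl C (c := S) rfl]
      exact π.map_bmul (mul_inv_cancel k) D S rfl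
    have h2 : π.toFun k D = π.toFun k C' * π.restrictUnit d :=
      π.map_bmul (mul_one k) C' d rfl
    have h3 : (π.restrictUnit d *
        π.restrictUnit (kmul (inv_mul_cancel k) (kstar rfl C) b)) ξ = 0 := hξ _
    rw [π.restrictUnit_kstar_kmul C b] at h3
    rw [h1, h2]
    change π.toFun k C' ((π.restrictUnit d * (star (π.toFun k C) * π.toFun k b)) ξ) = 0
    rw [h3, map_zero]
  obtain ⟨a, ha, had⟩ := hmem
  rwa [← Fibre.ext had]

end Homogeneous

theorem mainTheorem4 {G : Type u} [TopologicalSpace G] [T2Space G] [LocallyCompactSpace G]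
    [SecondCountableTopology G] [TopGroupoid G] {E : Type v} [TopologicalSpace E] (p : E → G)
    [FellBundle p] (hsep : IsSeparableBundle p)
    (P : Prim (sectionAlgebra p)) (hP : IsLocallyClosed ({P} : Set (Prim (sectionAlgebra p))))
    (x₀ : UnitSpace G) (hx₀ : IsStructurePoint P x₀)
    (μ : Measure (stabilityGroup P x₀)) [μ.IsHaarMeasure]
    {H : Type*} [NormedAddCommGroup H] [InnerProductSpace ℂ H] [CompleteSpace H]
    (L : fellCStar p (stabilityGroup P x₀) μ →⋆ₙₐ[ℂ] (H →L[ℂ] H)) 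
    (hL : IsIrreducibleRep (R := fellCStar p (stabilityGroup P x₀) μ) L)
    (π : FellRep p (stabilityGroup P x₀) H) (hLπ : IsIntegratedForm μ L π)
    (hker : TwoSidedIdeal.ker π.restrictUnit = idealAt P x₀) :
    IsHomogeneousRep π.restrictUnit := by

  have hmem : ∀ a, a ∈ idealAt P x₀ ↔ π.restrictUnit a = 0 := fun a => by
    rw [← hker, TwoSidedIdeal.mem_ker]
  have hset : (idealAt P x₀ : Set (Fibre p x₀.1)) = {a | π.restrictUnit a = 0} :=
    Set.ext hmem
  have hJ := isClosedFibreIdeal_of_isClosed (isClosed_idealAt P x₀)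
  have hK : ∀ k : stabilityGroup P x₀,
      rieffel p k.1.val (Fibre.val '' (idealAt P x₀ : Set (Fibre p x₀.1))) =
        Fibre.val '' (idealAt P x₀ : Set (Fibre p x₀.1)) := fun k => k.2
  rw [hset] at hJ
  rw [hset] at hK
  obtain ⟨d, hd, hdθ⟩ := exists_notMem_idealAt hP hx₀
  rw [hmem] at hd
  have hsub : ∀ e : H →L[ℂ] H, IsStarProjection e → (∀ a, Commute e (π.restrictUnit a)) →
      (∃ a, π.restrictUnit a ≠ 0 ∧ π.restrictUnit a * e = 0) → π.restrictUnit d * e = 0 := by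
    rintro e he hc ⟨a, ha, hae⟩
    refine hdθ (compress π.restrictUnit e he hc) (fun b hb => ?_)
      ⟨a, fun h => ha ((hmem a).1 h), hae⟩
    change π.restrictUnit b * e = 0
    rw [(hmem b).1 hb, zero_mul]
  refine ⟨FellRep.isNondegenerateRep_restrictUnit hL hLπ, fun e he he0 hc a ha => ?_⟩
  by_contra hne
  have hde := hsub e he hc ⟨a, hne, ContinuousLinearMap.ext ha⟩
  rcases FellRep.eq_bot_or_eq_top_of_invariant hL hLπ (isClosed_setOf_forall_eq_zero
    fun a => π.restrictUnit d * π.restrictUnit a)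
    (fun k b ξ hξ => π.toFun_mem_nullSubspace hd hJ hK hsub k b hξ) with h | h
  · -- the range of `e` is contained in the invariant subspace
    refine he0 (ContinuousLinearMap.ext fun ξ => ?_)
    change e ξ = 0
    rw [← Submodule.mem_bot ℂ, ← h]
    intro b
    change (π.restrictUnit d * (π.restrictUnit b * e)) ξ = 0
    rw [← (hc b).eq, ← mul_assoc, hde, zero_mul]
    rfl
  · -- all of `d A(u)` acts by zero, in particular `d d*`
    refine hd (CStarRing.mul_star_self_eq_zero_iff _ |>.1 (ContinuousLinearMap.ext fun ξ => ?_))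
    have hξ : ξ ∈ nullSubspace fun a => π.restrictUnit d * π.restrictUnit a := by
      rw [h]
      trivial
    rw [← map_star]
    exact hξ (star d)
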